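/- Let $A$ be a finite alphabet. A \emph{max-automaton} over $A$ has a finite set $Q$ of states with an initial state, a finite set $\Gamma$ of counters holding natural numbers (all initially $0$), and finitely many transitions; each transition leads from a state to a state, reads one letter, and performs a finite sequence of the operations $c:=c+1$, $c:=0$, $\mathrm{output}(c)$, $c:=\max(c,d)$ with $c,d\in\Gamma$. A run over $w\in A^\omega$ is an infinite sequence of consecutive transitions that starts in the initial state and reads $w$. It is accepting if it satisfies a given boolean combination of clauses "the sequence of values output on $c$ is bounded" ($c\in\Gamma$); the automaton recognizes the set of words that have an accepting run. It is \emph{deterministic} if for every state and letter there is exactly one applicable transition. \emph{Weak unbounding logic} over $A$ has the atomic formulas $a(x)$ ("position $x$ carries the letter $a$", for $a\in A$), $x=y$, $x\le y$, $x\in X$, is closed under boolean connectives, and allows quantification over positions $x\in\mathbb N$, quantification over finite sets $X\subseteq\mathbb N$ of positions, and the unbounding quantifier $$UX.\,\varphi(X)\;=\;\bigwedge_{k\in\mathbb N}\exists X\,\bigl(\varphi(X)\wedge k\le |X|<\infty\bigr).$$ A sentence defines the set of words $w\in A^\omega$ in which it is true. \textbf{Theorem.} A language $L\subseteq A^\omega$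 is defined by a sentence of weak unbounding logic if and only if it is recognized by a deterministic max-automaton. Moreover, the languages recognized by deterministic max-automata are closed under complement, union, intersection, weak quantification and unbounding quantification. The last two mean: if $L\subseteq (A\times\{0,1\})^\omega$ is recognized by a deterministic max-automaton, then so are $$\{w\in A^\omega : w[X]\in L\text{ for some finite }X\subseteq\mathbb N\}$$ and $$\{w\in A^\omega : \text{for every }k\in\mathbb N\text{ there is a finite }X\subseteq\mathbb N\text{ with } |X|\ge k\text{ and } w[X]\in L\},$$ where $w[X]$ is the word over $A\times\{0,1\}$ whose $i$-th letter is $(w_i,1)$ if $i\in X$ and $(w_i,0)$ otherwise. -/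

import Mathlib

universe u

/-! ## Max-automata -/

/-- The four counter operations over a set `Γ` of counters. -/
inductive CounterOp (Γ : Type) : Type
  /-- `c := c + 1` -/
  | incr (c : Γ)
  /-- `c := 0` -/
  | reset (c : Γ)
  /-- `output(c)` -/
  | output (c : Γ)
  /-- `c := max(c, d)` -/
  | max (c d : Γ)

namespace CounterOp

/-- The effect of one operation on a counter valuation. -/
def apply {Γ : Type} [DecidableEq Γ] : CounterOp Γ → (Γ → ℕ) → (Γ → ℕ)
  | incr c, v => Function.update v c (v c + 1)
  | reset c, v => Function.update v c 0
  | output _, v => v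
  | max c d, v => Function.update v c (Max.max (v c) (v d))

/-- The values (none or one) that a single operation outputs on the counter `c`. -/
def emitted {Γ : Type} [DecidableEq Γ] (c : Γ) : CounterOp Γ → (Γ → ℕ) → List ℕ
  | output d, v => if d = c then [v c] else []
  | _, _ => []

/-- The effect of a finite sequence of operations, executed from left to right. -/
def applyAll {Γ : Type} [DecidableEq Γ] : List (CounterOp Γ) → (Γ → ℕ) → (Γ → ℕ)
  | [], v => v
  | o :: os, v => applyAll os (o.apply v)

/-- The finite sequence of values output on the counter `c` while a finite sequence of operations
is executed from left to right. -/
def emittedAll {Γ : Type} [DecidableEq Γ] (c : Γ) : List (CounterOp Γ) → (Γ → ℕ) → List ℕ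
  | [], _ => []
  | o :: os, v => o.emitted c v ++ emittedAll c os (o.apply v)

end CounterOp

/-- Acceptance conditions: boolean combinations of the clauses
"the sequence of values output on counter `c` is bounded". -/
inductive BoundCond (Γ : Type) : Type
  | tru
  | bounded (c : Γ)
  | not (α : BoundCond Γ)
  | and (α β : BoundCond Γ)
  | or (α β : BoundCond Γ)

/-- The truth value of a boolean combination, given the truth values of the clauses. -/
def BoundCond.Holds {Γ : Type} (isBounded : Γ → Prop) : BoundCond Γ → Prop
  | tru => True
  | bounded c => isBounded c
  | not α => ¬ α.Holds isBounded
  | and α β => α.Holds isBounded ∧ β.Holds isBounded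
  | or α β => α.Holds isBounded ∨ β.Holds isBounded

/-- A transition reads a letter, changes the state and performs a finite sequence of counter
operations. -/
structure MaxTransition (A : Type u) (Q Γ : Type) where
  source : Q
  letter : A
  ops : List (CounterOp Γ)
  target : Q

/-- A (possibly nondeterministic) max-automaton over the alphabet `A`, with states `Q` and
counters `Γ`. The finiteness of `Q` and `Γ` is imposed in `IsDetMaxRecognizable`. -/
structure MaxAutomaton (A : Type u) (Q Γ : Type) where
  start : Q
  trans : Set (MaxTransition A Q Γ)
  finite_trans : trans.Finite
  acc : BoundCond Γ

namespace MaxAutomaton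

/-- `ρ` is a run over the infinite word `w`. -/
structure IsRun {A : Type u} {Q Γ : Type} (M : MaxAutomaton A Q Γ) (w : ℕ → A)
    (ρ : ℕ → MaxTransition A Q Γ) : Prop where
  mem_trans : ∀ i, ρ i ∈ M.trans
  start_eq : (ρ 0).source = M.start
  letter_eq : ∀ i, (ρ i).letter = w i
  next_eq : ∀ i, (ρ (i + 1)).source = (ρ i).target

/-- The counter values just before the `i`-th transition of `ρ`. All counters start at `0`. -/
def valueAt {A : Type u} {Q Γ : Type} [DecidableEq Γ] (ρ : ℕ → MaxTransition A Q Γ) :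
    ℕ → Γ → ℕ
  | 0 => fun _ => 0
  | i + 1 => CounterOp.applyAll (ρ i).ops (valueAt ρ i)

/-- The (finite or infinite) sequence of all values output on the counter `c` along `ρ`
is bounded. -/
def OutputBounded {A : Type u} {Q Γ : Type} [DecidableEq Γ] (ρ : ℕ → MaxTransition A Q Γ)
    (c : Γ) : Prop :=
  ∃ N : ℕ, ∀ i, ∀ v ∈ CounterOp.emittedAll c (ρ i).ops (valueAt ρ i), v ≤ N

/-- The language recognized by `M`: the infinite words that have an accepting run. -/
def language {A : Type u} {Q Γ : Type} [DecidableEq Γ] (M : MaxAutomaton A Q Γ) :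
    Set (ℕ → A) :=
  {w | ∃ ρ, M.IsRun w ρ ∧ M.acc.Holds (OutputBounded ρ)}

/-- For every state and letter there is exactly one applicable transition. -/
def IsDeterministic {A : Type u} {Q Γ : Type} (M : MaxAutomaton A Q Γ) : Prop :=
  ∀ (q : Q) (a : A), ∃! t, t ∈ M.trans ∧ t.source = q ∧ t.letter = a

end MaxAutomaton

/-- `L` is recognized by some deterministic max-automaton with finitely many states and counters. -/
def IsDetMaxRecognizable {A : Type u} (L : Set (ℕ → A)) : Prop :=
  ∃ (Q Γ : Type) (_ : Finite Q) (_ : Finite Γ) (_ : DecidableEq Γ) (M : MaxAutomaton A Q Γ),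
    M.IsDeterministic ∧ M.language = L

/-! ## Weak unbounding logic -/

/-- Formulas of weak unbounding logic over the alphabet `A`, with first-order variables `Fin m`
and set variables `Fin n`. A quantifier binds the variable `0` of its body and shifts the others
by one. The remaining connectives and universal quantifiers are the usual abbreviations. -/
inductive WUFormula (A : Type u) : ℕ → ℕ → Type u
  /-- `a(x)`: position `x` carries the letter `a` -/
  | letter {m n : ℕ} (a : A) (x : Fin m) : WUFormula A m n
  /-- `x = y` -/
  | eq {m n : ℕ} (x y : Fin m) : WUFormula A m n
  /-- `x ≤ y` -/
  | le {m n : ℕ} (x y : Fin m) : WUFormula A m n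
  /-- `x ∈ X` -/
  | mem {m n : ℕ} (x : Fin m) (X : Fin n) : WUFormula A m n
  | not {m n : ℕ} (φ : WUFormula A m n) : WUFormula A m n
  | and {m n : ℕ} (φ ψ : WUFormula A m n) : WUFormula A m n
  | or {m n : ℕ} (φ ψ : WUFormula A m n) : WUFormula A m n
  /-- `∃ x, φ`, over positions -/
  | exPos {m n : ℕ} (φ : WUFormula A (m + 1) n) : WUFormula A m n
  /-- `∃ X, φ`, over finite sets of positions -/
  | exSet {m n : ℕ} (φ : WUFormula A m (n + 1)) : WUFormula A m n
  /-- `U X, φ`: there are arbitrarily large finite sets `X` satisfying `φ` -/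
  | unb {m n : ℕ} (φ : WUFormula A m (n + 1)) : WUFormula A m n

namespace WUFormula

/-- Satisfaction of a formula in the infinite word `w`, under a valuation `s` of the first-order
variables by positions and a valuation `S` of the set variables by sets of positions. -/
def Sat {A : Type u} (w : ℕ → A) :
    {m n : ℕ} → WUFormula A m n → (Fin m → ℕ) → (Fin n → Set ℕ) → Prop
  | _, _, letter a x, s, _ => w (s x) = a
  | _, _, eq x y, s, _ => s x = s y
  | _, _, le x y, s, _ => s x ≤ s y
  | _, _, mem x X, s, S => s x ∈ S X
  | _, _, not φ, s, S => ¬ φ.Sat w s S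
  | _, _, and φ ψ, s, S => φ.Sat w s S ∧ ψ.Sat w s S
  | _, _, or φ ψ, s, S => φ.Sat w s S ∨ ψ.Sat w s S
  | m, _, exPos φ, s, S => ∃ x : ℕ, φ.Sat w (Fin.cons x s : Fin (m + 1) → ℕ) S
  | _, n, exSet φ, s, S =>
      ∃ X : Finset ℕ, φ.Sat w s (Fin.cons (X : Set ℕ) S : Fin (n + 1) → Set ℕ)
  | _, n, unb φ, s, S =>
      ∀ k : ℕ, ∃ X : Finset ℕ,
        φ.Sat w s (Fin.cons (X : Set ℕ) S : Fin (n + 1) → Set ℕ) ∧ k ≤ X.card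

/-- The language defined by a sentence (a formula without free variables). -/
def language {A : Type u} (φ : WUFormula A 0 0) : Set (ℕ → A) :=
  {w | φ.Sat w Fin.elim0 Fin.elim0}

end WUFormula

/-- `L` is defined by some sentence of weak unbounding logic. -/
def IsWeakUnboundingDefinable {A : Type u} (L : Set (ℕ → A)) : Prop :=
  ∃ φ : WUFormula A 0 0, φ.language = L

/-! ## Quantification as an operation on languages -/

/-- The word `w[X]` over `A × {0, 1}`: the second component marks the positions in `X`. -/
def annotate {A : Type u} (w : ℕ → A) (X : Finset ℕ) : ℕ → A × Bool :=
  fun i => (w i, decide (i ∈ X))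

/-- The words `w` such that `w[X] ∈ L` for some finite set `X`. -/
def weakExists {A : Type u} (L : Set (ℕ → A × Bool)) : Set (ℕ → A) :=
  {w | ∃ X : Finset ℕ, annotate w X ∈ L}

/-- The words `w` such that `w[X] ∈ L` for arbitrarily large finite sets `X`. -/
def unboundedly {A : Type u} (L : Set (ℕ → A × Bool)) : Set (ℕ → A) :=
  {w | ∀ k : ℕ, ∃ X : Finset ℕ, annotate w X ∈ L ∧ k ≤ X.card}

/-! ## Boolean combinations -/

namespace BoundCond

/-! Automata and logic are both compared with a third class, `IsReachDefinable`: boolean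
combinations of conditions `UnbReach`, which ask a finite nondeterministic graph with edge weights 0
and 1 for paths of unbounded weight over prefixes of the word. Disjoint unions of graphs give the
boolean closure.

A deterministic max-automaton checks such a condition by remembering the set of reached states and
storing for each the largest weight of a path to it (`detBounded_reachOps_iff`). Conversely, a
counter value is, up to constants, the weight of a path that traces the value back to its origin
(`detBounded_iff_not_unbReach`).

The crux is `IsReachDefinable.quantify`. Once the finite set `X` has ended, the word is unmarked,
and membership depends only on the suffix and on the set of states reached so far
(`unbReach_suffix`). But the time at which `X` ends is unbounded. So the runs of the power-set
automaton over unmarked letters are all tracked at once in finitely many slots. Runs that merge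
continue in the least of their slots, and the freed slots are reused. Slot numbers only decrease, so
every run settles in a slot that merges no more (`exists_slot_of_run`). The quantified property then
says that some slot merges only finitely often, is entered after arbitrarily large sets, and
satisfies the acceptance condition. Each of these is again expressed with `UnbReach`.

Formulas are translated into this class by induction. Conversely, a set `X` marks the edges of
weight 1 on a path, finite sets tabulate the states reachable under this marking, and the unbounding
quantifier over `X` expresses `UnbReach`. -/

def map {Γ Γ' : Type} (f : Γ → Γ') : BoundCond Γ → BoundCond Γ'
  | tru => tru
  | bounded c => bounded (f c)
  | not α => not (α.map f)
  | and α β => and (α.map f) (β.map f)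
  | or α β => or (α.map f) (β.map f)

theorem holds_map {Γ Γ' : Type} (f : Γ → Γ') (p : Γ' → Prop) (α : BoundCond Γ) :
    (α.map f).Holds p ↔ α.Holds (fun c => p (f c)) := by
  induction α with
  | tru => rfl
  | bounded c => rfl
  | not α ih => exact not_congr ih
  | and α β ih₁ ih₂ => exact and_congr ih₁ ih₂
  | or α β ih₁ ih₂ => exact or_congr ih₁ ih₂

theorem holds_congr {Γ : Type} {p q : Γ → Prop} (h : ∀ c, p c ↔ q c) (α : BoundCond Γ) :
    α.Holds p ↔ α.Holds q := by
  rw [funext fun c => propext (h c)]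

end BoundCond

/-! ## Weighted reachability -/

/-- The state reached by a deterministic transition function after `n` letters. -/
def detRun {A : Type u} {Q : Type} (f : Q → A → Q) (q : Q) (w : ℕ → A) : ℕ → Q
  | 0 => q
  | n + 1 => f (detRun f q w n) (w n)

theorem detRun_congr {A : Type u} {Q : Type} (f : Q → A → Q) (q : Q) {w w' : ℕ → A} {n : ℕ}
    (h : ∀ i < n, w i = w' i) : detRun f q w n = detRun f q w' n := by
  induction n with
  | zero => rfl
  | succ n ih => rw [detRun, detRun, ih fun i hi => h i (by omega), h n (by omega)]

/-- `WReach E T w n k s`: some path of the graph `E` with `{0, 1}`-weighted edges reads the first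
`n` letters of `w`, leads from `T` to `s`, and has weight `k`. -/
inductive WReach {A : Type u} {σ : Type} (E : σ → A → Bool → σ → Prop) (T : Set σ) (w : ℕ → A) :
    ℕ → ℕ → σ → Prop
  | init {s : σ} (h : s ∈ T) : WReach E T w 0 0 s
  | snoc {n k : ℕ} {s s' : σ} (b : Bool) (h : WReach E T w n k s) (hE : E s (w n) b s') :
      WReach E T w (n + 1) (k + b.toNat) s'

/-- There are paths from `T` to `F` of arbitrarily large weight that read prefixes of `w`. -/
def UnbReach {A : Type u} {σ : Type} (E : σ → A → Bool → σ → Prop) (T : Set σ) (w : ℕ → A)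
    (F : Set σ) : Prop :=
  ∀ k, ∃ n k' s, k ≤ k' ∧ s ∈ F ∧ WReach E T w n k' s

section WReach

variable {A : Type u} {σ : Type} {E : σ → A → Bool → σ → Prop} {T : Set σ} {w : ℕ → A}

theorem wReach_zero {k : ℕ} {s : σ} : WReach E T w 0 k s ↔ k = 0 ∧ s ∈ T := by
  constructor
  · intro h
    cases h with
    | init h => exact ⟨rfl, h⟩
  · rintro ⟨rfl, h⟩
    exact .init h

theorem wReach_succ {n k : ℕ} {s' : σ} : WReach E T w (n + 1) k s' ↔
    ∃ k₀ s b, WReach E T w n k₀ s ∧ E s (w n) b s' ∧ k = k₀ + b.toNat := by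
  constructor
  · intro h
    cases h with
    | snoc b h hE => exact ⟨_, _, b, h, hE, rfl⟩
  · rintro ⟨k₀, s, b, h, hE, rfl⟩
    exact .snoc b h hE

theorem WReach.le {n k : ℕ} {s : σ} (h : WReach E T w n k s) : k ≤ n := by
  induction h with
  | init => rfl
  | snoc b _ _ ih => have := b.toNat_le; omega

/-- Pigeonhole: if every index failed somewhere, all of them would fail at a common upper bound of
the failure points. -/
theorem exists_uniform_of_antitone {ι : Type} [Finite ι] {P : ι → ℕ → Prop}
    (hP : ∀ i k l, k ≤ l → P i l → P i k) (h : ∀ k, ∃ i, P i k) : ∃ i, ∀ k, P i k := by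
  by_contra! hc
  choose f hf using hc
  obtain ⟨M, hM⟩ := (Set.finite_range f).bddAbove
  obtain ⟨i, hi⟩ := h M
  exact hf i (hP i _ _ (hM ⟨i, rfl⟩) hi)

theorem unbReach_iff_exists [Finite σ] {F : Set σ} :
    UnbReach E T w F ↔ ∃ q ∈ F, UnbReach E T w {q} := by
  constructor
  · intro h
    obtain ⟨q, hq⟩ := exists_uniform_of_antitone
      (P := fun q k => q ∈ F ∧ ∃ n k', k ≤ k' ∧ WReach E T w n k' q)
      (fun q k l hkl ⟨hF, n, k', hk, hr⟩ => ⟨hF, n, k', hkl.trans hk, hr⟩)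
      (fun k => by
        obtain ⟨n, k', s, hk, hs, hr⟩ := h k
        exact ⟨s, hs, n, k', hk, hr⟩)
    refine ⟨q, (hq 0).1, fun k => ?_⟩
    obtain ⟨_, n, k', hk, hr⟩ := hq k
    exact ⟨n, k', q, hk, rfl, hr⟩
  · rintro ⟨q, hq, h⟩ k
    obtain ⟨n, k', s, hk, rfl, hr⟩ := h k
    exact ⟨n, k', s, hk, hq, hr⟩

/-- The deterministic transition function on sets of states. -/
def succSet (E : σ → A → Bool → σ → Prop) (T : Set σ) (a : A) : Set σ :=
  {s' | ∃ s ∈ T, ∃ b, E s a b s'}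

theorem mem_detRun_succSet {n : ℕ} {s : σ} :
    s ∈ detRun (succSet E) T w n ↔ ∃ k, WReach E T w n k s := by
  induction n generalizing s with
  | zero => simp [detRun, wReach_zero]
  | succ n ih =>
    simp only [detRun, succSet, Set.mem_ofPred_eq, ih, wReach_succ]
    constructor
    · rintro ⟨s, ⟨k, h⟩, b, hE⟩
      exact ⟨_, _, _, _, h, hE, rfl⟩
    · rintro ⟨_, k, s, b, h, hE, rfl⟩
      exact ⟨s, ⟨_, h⟩, b, hE⟩

theorem WReach.suffix {n m k : ℕ} {s : σ} (h : WReach E T w (n + m) k s) :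
    ∃ k', k ≤ k' + n ∧
      WReach E (detRun (succSet E) T w n) (fun i => w (n + i)) m k' s := by
  induction m generalizing k s with
  | zero => exact ⟨0, by simpa using h.le, .init (mem_detRun_succSet.2 ⟨k, h⟩)⟩
  | succ m ih =>
    obtain ⟨k₀, s₀, b, h₀, hE, rfl⟩ := wReach_succ.1 h
    obtain ⟨k', hk, hr⟩ := ih h₀
    exact ⟨_, by omega, .snoc b hr hE⟩

theorem WReach.prepend {n m k : ℕ} {s : σ}
    (h : WReach E (detRun (succSet E) T w n) (fun i => w (n + i)) m k s) :
    ∃ k', k ≤ k' ∧ WReach E T w (n + m) k' s := by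
  induction m generalizing k s with
  | zero =>
    obtain ⟨rfl, hs⟩ := wReach_zero.1 h
    obtain ⟨k', h'⟩ := mem_detRun_succSet.1 hs
    exact ⟨k', by omega, h'⟩
  | succ m ih =>
    obtain ⟨k₀, s₀, b, h₀, hE, rfl⟩ := wReach_succ.1 h
    obtain ⟨k', hk, hr⟩ := ih h₀
    exact ⟨_, by omega, .snoc b hr hE⟩

/-- Cutting off `n` letters costs at most `n` of weight and restoring them costs nothing, so
unboundedness sees only the reached set and the remaining word. -/
theorem unbReach_suffix (n : ℕ) {F : Set σ} : UnbReach E T w F ↔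
    UnbReach E (detRun (succSet E) T w n) (fun i => w (n + i)) F := by
  constructor
  · intro h k
    obtain ⟨N, k', s, hk, hs, hr⟩ := h (k + n)
    have := hr.le
    obtain ⟨m, rfl⟩ := Nat.exists_eq_add_of_le (show n ≤ N by omega)
    obtain ⟨k'', hk'', hr⟩ := hr.suffix
    exact ⟨m, k'', s, by omega, hs, hr⟩
  · intro h k
    obtain ⟨m, k', s, hk, hs, hr⟩ := h k
    obtain ⟨k'', hk'', hr⟩ := hr.prepend
    exact ⟨_, k'', s, by omega, hs, hr⟩

end WReach

/-! ## Languages defined by weighted reachability -/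

/-- `L` is a boolean combination of conditions "there are paths of unbounded weight ending in the
state `q`" in some finite graph. -/
def IsReachDefinable {A : Type u} (L : Set (ℕ → A)) : Prop :=
  ∃ (σ : Type) (_ : Finite σ) (E : σ → A → Bool → σ → Prop) (T : Set σ) (α : BoundCond σ),
    ∀ w, w ∈ L ↔ α.Holds (fun q => ¬ UnbReach E T w {q})

/-- The disjoint union of two graphs. -/
def sumEdge {A : Type u} {σ₁ σ₂ : Type} (E₁ : σ₁ → A → Bool → σ₁ → Prop)
    (E₂ : σ₂ → A → Bool → σ₂ → Prop) : σ₁ ⊕ σ₂ → A → Bool → σ₁ ⊕ σ₂ → Prop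
  | .inl s, a, b, .inl s' => E₁ s a b s'
  | .inr s, a, b, .inr s' => E₂ s a b s'
  | _, _, _, _ => False

section sumEdge

variable {A : Type u} {σ₁ σ₂ : Type} {E₁ : σ₁ → A → Bool → σ₁ → Prop}
  {E₂ : σ₂ → A → Bool → σ₂ → Prop} {T₁ : Set σ₁} {T₂ : Set σ₂} {w : ℕ → A}

theorem wReach_sumEdge_inl {n k : ℕ} {s : σ₁} :
    WReach (sumEdge E₁ E₂) (Sum.inl '' T₁ ∪ Sum.inr '' T₂) w n k (.inl s) ↔
      WReach E₁ T₁ w n k s := by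
  induction n generalizing k s with
  | zero => simp [wReach_zero]
  | succ n ih => simp [wReach_succ, ih, sumEdge]

theorem wReach_sumEdge_inr {n k : ℕ} {s : σ₂} :
    WReach (sumEdge E₁ E₂) (Sum.inl '' T₁ ∪ Sum.inr '' T₂) w n k (.inr s) ↔
      WReach E₂ T₂ w n k s := by
  induction n generalizing k s with
  | zero => simp [wReach_zero]
  | succ n ih => simp [wReach_succ, ih, sumEdge]

end sumEdge

/-! ### Boolean closure and relabelling -/

namespace IsReachDefinable

variable {A : Type u} {L K : Set (ℕ → A)}

theorem compl (h : IsReachDefinable L) : IsReachDefinable Lᶜ := by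
  obtain ⟨σ, hσ, E, T, α, h⟩ := h
  exact ⟨σ, hσ, E, T, .not α, fun w => not_congr (h w)⟩

theorem inter (hL : IsReachDefinable L) (hK : IsReachDefinable K) :
    IsReachDefinable (L ∩ K) := by
  obtain ⟨σ₁, _, E₁, T₁, α₁, h₁⟩ := hL
  obtain ⟨σ₂, _, E₂, T₂, α₂, h₂⟩ := hK
  refine ⟨σ₁ ⊕ σ₂, inferInstance, sumEdge E₁ E₂, Sum.inl '' T₁ ∪ Sum.inr '' T₂,
    .and (α₁.map Sum.inl) (α₂.map Sum.inr), fun w => ?_⟩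
  rw [Set.mem_inter_iff, h₁, h₂, BoundCond.Holds, BoundCond.holds_map, BoundCond.holds_map]
  simp [UnbReach, wReach_sumEdge_inl, wReach_sumEdge_inr]

theorem union (hL : IsReachDefinable L) (hK : IsReachDefinable K) :
    IsReachDefinable (L ∪ K) := by
  have := (hL.compl.inter hK.compl).compl
  rwa [Set.compl_inter, compl_compl, compl_compl] at this

theorem empty : IsReachDefinable (∅ : Set (ℕ → A)) :=
  ⟨PUnit, inferInstance, fun _ _ _ _ => True, ∅, .not .tru, fun w => by simp [BoundCond.Holds]⟩

theorem iUnion {ι : Type} [Finite ι] {L : ι → Set (ℕ → A)} (h : ∀ i, IsReachDefinable (L i)) :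
    IsReachDefinable (⋃ i, L i) := by
  classical
  have key : ∀ s : Finset ι, IsReachDefinable (⋃ i ∈ s, L i) := by
    intro s
    induction s using Finset.induction_on with
    | empty => simpa using empty
    | insert i s _ ih =>
      rw [Finset.set_biUnion_insert]
      exact (h i).union ih
  have := Fintype.ofFinite ι
  simpa using key Finset.univ

theorem unbReach {σ : Type} [Finite σ] (E : σ → A → Bool → σ → Prop) (T F : Set σ) :
    IsReachDefinable {w | UnbReach E T w F} := by
  have : {w | UnbReach E T w F} = ⋃ q : F, {w | UnbReach E T w {q.1}} := by
    ext w
    simp [unbReach_iff_exists (F := F)]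
  rw [this]
  exact iUnion fun q => ⟨σ, inferInstance, E, T, .not (.bounded q), fun w => by
    simp [BoundCond.Holds]⟩

theorem holds {Γ : Type} {P : (ℕ → A) → Γ → Prop} (h : ∀ c, IsReachDefinable {w | P w c})
    (α : BoundCond Γ) : IsReachDefinable {w | α.Holds (P w)} := by
  induction α with
  | tru => simpa [BoundCond.Holds] using (empty (A := A)).compl
  | bounded c => exact h c
  | not α ih => exact ih.compl
  | and α β ih₁ ih₂ => exact ih₁.inter ih₂
  | or α β ih₁ ih₂ => exact ih₁.union ih₂

theorem comap {B : Type u} (f : A → B) {L : Set (ℕ → B)} (h : IsReachDefinable L) :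
    IsReachDefinable {w : ℕ → A | (fun i => f (w i)) ∈ L} := by
  obtain ⟨σ, hσ, E, T, α, h⟩ := h
  refine ⟨σ, hσ, fun s a => E s (f a), T, α, fun w => ?_⟩
  rw [Set.mem_ofPred_eq, h]
  have key : ∀ n k s, WReach E T (fun i => f (w i)) n k s ↔
      WReach (fun s a => E s (f a)) T w n k s := by
    intro n
    induction n with
    | zero => simp [wReach_zero]
    | succ n ih => simp [wReach_succ, ih]
  simp only [UnbReach, key]

end IsReachDefinable

/-! ## Deterministic max-automata given by transition functions -/

/-- The counter values after `n` letters of a deterministic automaton. -/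
def ctrRun {A : Type u} {Q Γ : Type} [DecidableEq Γ] (next : Q → A → Q)
    (ops : Q → A → List (CounterOp Γ)) (q : Q) (w : ℕ → A) : ℕ → Γ → ℕ
  | 0 => fun _ => 0
  | n + 1 => CounterOp.applyAll (ops (detRun next q w n) (w n)) (ctrRun next ops q w n)

/-- The outputs on the counter `c` are bounded. -/
def DetBounded {A : Type u} {Q Γ : Type} [DecidableEq Γ] (next : Q → A → Q)
    (ops : Q → A → List (CounterOp Γ)) (q : Q) (w : ℕ → A) (c : Γ) : Prop :=
  ∃ N, ∀ i, ∀ v ∈ CounterOp.emittedAll c (ops (detRun next q w i) (w i))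
    (ctrRun next ops q w i), v ≤ N

theorem MaxAutomaton.valueAt_eq_ctrRun {A : Type u} {Q Γ : Type} [DecidableEq Γ]
    {next : Q → A → Q} {ops : Q → A → List (CounterOp Γ)} {q : Q} {w : ℕ → A}
    {ρ : ℕ → MaxTransition A Q Γ}
    (h : ∀ i, (ρ i).ops = ops (detRun next q w i) (w i)) (n : ℕ) :
    valueAt ρ n = ctrRun next ops q w n := by
  induction n with
  | zero => rfl
  | succ n ih => rw [valueAt, ih, h, ctrRun]

theorem MaxAutomaton.outputBounded_iff_detBounded {A : Type u} {Q Γ : Type} [DecidableEq Γ]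
    {next : Q → A → Q} {ops : Q → A → List (CounterOp Γ)} {q : Q} {w : ℕ → A}
    {ρ : ℕ → MaxTransition A Q Γ}
    (h : ∀ i, (ρ i).ops = ops (detRun next q w i) (w i)) (c : Γ) :
    OutputBounded ρ c ↔ DetBounded next ops q w c := by
  simp only [OutputBounded, DetBounded, valueAt_eq_ctrRun h, h]

theorem MaxAutomaton.IsDeterministic.exists_functions {A : Type u} {Q Γ : Type} [DecidableEq Γ]
    {M : MaxAutomaton A Q Γ} (hM : M.IsDeterministic) :
    ∃ (next : Q → A → Q) (ops : Q → A → List (CounterOp Γ)),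
      ∀ w, w ∈ M.language ↔ M.acc.Holds (DetBounded next ops M.start w) := by
  choose t ht huniq using hM
  refine ⟨fun q a => (t q a).target, fun q a => (t q a).ops, fun w => ?_⟩
  set next : Q → A → Q := fun q a => (t q a).target with hnext
  have hrun : M.IsRun w fun i => t (detRun next M.start w i) (w i) :=
    { mem_trans := fun i => (ht _ _).1
      start_eq := (ht _ _).2.1
      letter_eq := fun i => (ht _ _).2.2
      next_eq := fun i => (ht _ _).2.1 }
  constructor
  · rintro ⟨ρ, hρ, hacc⟩
    have hsrc : ∀ i, (ρ i).source = detRun next M.start w i := by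
      intro i
      induction i with
      | zero => exact hρ.start_eq
      | succ i ih =>
        rw [hρ.next_eq, detRun, hnext, ← ih]
        congr 1
        exact huniq _ _ _ ⟨hρ.mem_trans i, rfl, hρ.letter_eq i⟩
    have hops : ∀ i, (ρ i).ops = (t (detRun next M.start w i) (w i)).ops := by
      intro i
      congr 1
      exact huniq _ _ _ ⟨hρ.mem_trans i, hsrc i, hρ.letter_eq i⟩
    exact (BoundCond.holds_congr (outputBounded_iff_detBounded
      (ops := fun q a => (t q a).ops) hops) _).1 hacc
  · intro h
    exact ⟨_, hrun, (BoundCond.holds_congr (outputBounded_iff_detBounded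
      (ops := fun q a => (t q a).ops) fun i => rfl) _).2 h⟩

theorem isDetMaxRecognizable_of_functions {A : Type u} [Finite A] {Q Γ : Type} [Finite Q]
    [Finite Γ] [DecidableEq Γ] (next : Q → A → Q) (ops : Q → A → List (CounterOp Γ)) (q : Q)
    (α : BoundCond Γ) {L : Set (ℕ → A)} (h : ∀ w, w ∈ L ↔ α.Holds (DetBounded next ops q w)) :
    IsDetMaxRecognizable L := by
  let t : Q × A → MaxTransition A Q Γ := fun p => ⟨p.1, p.2, ops p.1 p.2, next p.1 p.2⟩
  let M : MaxAutomaton A Q Γ := ⟨q, Set.range t, Set.finite_range t, α⟩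
  have hM : M.IsDeterministic := by
    intro q a
    refine ⟨t (q, a), ⟨⟨_, rfl⟩, rfl, rfl⟩, ?_⟩
    rintro _ ⟨⟨p, rfl⟩, rfl, rfl⟩
    rfl
  refine ⟨Q, Γ, inferInstance, inferInstance, inferInstance, M, hM, ?_⟩
  ext w
  rw [h]
  constructor
  · rintro ⟨ρ, hρ, hacc⟩
    have hρt : ∀ i, ρ i = t ((ρ i).source, w i) := by
      intro i
      obtain ⟨p, hp⟩ := hρ.mem_trans i
      rw [← hρ.letter_eq, ← hp]
    have hsrc : ∀ i, (ρ i).source = detRun next q w i := by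
      intro i
      induction i with
      | zero => exact hρ.start_eq
      | succ i ih => rw [hρ.next_eq, hρt, detRun, ← ih]
    refine (BoundCond.holds_congr (MaxAutomaton.outputBounded_iff_detBounded fun i => ?_) _).1 hacc
    rw [hρt i, hsrc]
  · intro hacc
    exact ⟨fun i => t (detRun next q w i, w i), ⟨fun i => ⟨_, rfl⟩, rfl, fun i => rfl,
      fun i => rfl⟩, (BoundCond.holds_congr
        (MaxAutomaton.outputBounded_iff_detBounded fun i => rfl) _).2 hacc⟩

/-! ## Paths through a sequence of counter operations -/

namespace CounterOp

variable {Γ : Type} [DecidableEq Γ]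

/-- `Flow l d c k`: the value of `c` after the operations `l` may come from the value of `d`
before them, with `k` increments on the way. -/
inductive Flow : List (CounterOp Γ) → Γ → Γ → ℕ → Prop
  | nil (c : Γ) : Flow [] c c 0
  | incr {os : List (CounterOp Γ)} {d c : Γ} {k : ℕ} (h : Flow os d c k) :
      Flow (incr d :: os) d c (k + 1)
  | keep {os : List (CounterOp Γ)} {d c : Γ} {k : ℕ} (o : CounterOp Γ) (ho : o ≠ reset d)
      (h : Flow os d c k) : Flow (o :: os) d c k
  | max {os : List (CounterOp Γ)} {d e c : Γ} {k : ℕ} (h : Flow os d c k) :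
      Flow (max d e :: os) e c k

/-- A flow may undercount: `keep` also passes over `incr d` and `max d e`, which can only raise `d`.
Hence only a lower bound. -/
theorem Flow.le_applyAll {l : List (CounterOp Γ)} {d c : Γ} {k : ℕ} (h : Flow l d c k)
    (v : Γ → ℕ) : v d + k ≤ applyAll l v c := by
  induction h generalizing v with
  | nil => simp [applyAll]
  | @incr os d c k h ih =>
    have := ih (apply (.incr d) v)
    simp only [apply, Function.update_self] at this
    rw [applyAll, apply]
    omega
  | @keep os d c k o ho h ih =>
    refine le_trans ?_ (ih (apply o v))
    gcongr
    cases o with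
    | incr e => by_cases h : d = e <;> simp [apply, h]
    | reset e =>
      have h : d ≠ e := fun h => ho (h ▸ rfl)
      simp [apply, h]
    | output e => exact le_rfl
    | max e f => by_cases h : d = e <;> simp [apply, h]
  | @max os d e c k h ih =>
    have := ih (apply (.max d e) v)
    simp only [apply, Function.update_self] at this
    rw [applyAll, apply]
    omega

/-- Traced backwards, the value either originates in a reset inside `l`, after which at most
`l.length` increments follow, or comes from a counter `d` before `l`. -/
theorem exists_flow (l : List (CounterOp Γ)) (v : Γ → ℕ) (c : Γ) :
    applyAll l v c ≤ l.length ∨ ∃ d k, Flow l d c k ∧ k ≤ l.length ∧ applyAll l v c ≤ v d + k := by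
  induction l generalizing v with
  | nil => exact .inr ⟨c, 0, .nil c, le_rfl, le_rfl⟩
  | cons o os ih =>
    rw [applyAll, List.length_cons]
    rcases ih (o.apply v) with h | ⟨d, k, hf, hk, h⟩
    · exact .inl (by omega)
    · have keep (ho : o ≠ reset d) (hv : o.apply v d = v d) :
          ∃ d k, Flow (o :: os) d c k ∧ k ≤ os.length + 1 ∧ applyAll os (o.apply v) c ≤ v d + k :=
        ⟨d, k, .keep o ho hf, by omega, by omega⟩
      cases o with
      | incr e =>
        by_cases hde : d = e
        · subst hde
          simp only [apply, Function.update_self] at h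
          exact .inr ⟨d, k + 1, .incr hf, by omega, by simp only [apply]; omega⟩
        · exact .inr (keep (by simp) (by simp [apply, hde]))
      | reset e =>
        by_cases hde : d = e
        · subst hde
          simp only [apply, Function.update_self] at h
          exact .inl (by simp only [apply]; omega)
        · exact .inr (keep (by simpa using Ne.symm hde) (by simp [apply, hde]))
      | output e => exact .inr (keep (by simp) rfl)
      | max e f =>
        by_cases hde : d = e
        · subst hde
          simp only [apply, Function.update_self] at h
          rcases le_total (v d) (v f) with hdf | hdf
          · exact .inr ⟨f, k, .max hf, by omega, by simp only [apply]; omega⟩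
          · exact .inr ⟨d, k, .keep _ (by simp) hf, by omega, by simp only [apply]; omega⟩
        · exact .inr (keep (by simp) (by simp [apply, hde]))

theorem mem_emittedAll {c : Γ} {l : List (CounterOp Γ)} {v : Γ → ℕ} {x : ℕ} :
    x ∈ emittedAll c l v ↔ ∃ l₁ l₂, l = l₁ ++ output c :: l₂ ∧ x = applyAll l₁ v c := by
  induction l generalizing v with
  | nil => simp [emittedAll]
  | cons o os ih =>
    rw [emittedAll, List.mem_append, ih]
    constructor
    · rintro (h | ⟨l₁, l₂, rfl, rfl⟩)
      · cases o with
        | output d =>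
          by_cases hd : d = c
          · subst hd
            exact ⟨[], os, rfl, by simpa [emitted, applyAll] using h⟩
          · simp [emitted, hd] at h
        | _ => simp [emitted] at h
      · exact ⟨o :: l₁, l₂, rfl, rfl⟩
    · rintro ⟨_ | ⟨o', l₁⟩, l₂, h, rfl⟩
      · simp only [List.nil_append, List.cons.injEq] at h
        obtain ⟨rfl, rfl⟩ := h
        simp [emitted, applyAll]
      · simp only [List.cons_append, List.cons.injEq] at h
        obtain ⟨rfl, rfl⟩ := h
        exact .inr ⟨l₁, l₂, rfl, rfl⟩

end CounterOp

/-! ## From deterministic max-automata to weighted reachability -/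

section Trace

variable {A : Type u} {Q Γ : Type}

/-- The graph that follows the origin of a counter value through the run of an automaton and ends
at an output on `c`. The states `some (q, none)` precede the part that is followed. -/
def traceEdge (next : Q → A → Q) (ops : Q → A → List (CounterOp Γ)) (c : Γ) :
    Option (Q × Option Γ) → A → Bool → Option (Q × Option Γ) → Prop
  | some (q, none), a, b, some (q', _) => q' = next q a ∧ b = false
  | some (q, some d), a, b, some (q', some e) =>
      q' = next q a ∧ ∃ k, CounterOp.Flow (ops q a) d e k ∧ b.toNat ≤ k ∧ (k ≠ 0 → b = true)
  | some (q, some d), a, b, none => b = false ∧ ∃ l₁ l₂ k,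
      ops q a = l₁ ++ .output c :: l₂ ∧ CounterOp.Flow l₁ d c k
  | _, _, _, _ => False

/-- Since all counters start at 0, a trace may follow any counter from the beginning, or wait. -/
def traceStart (q : Q) : Set (Option (Q × Option Γ)) :=
  {s | ∃ o, s = some (q, o)}

variable {next : Q → A → Q} {ops : Q → A → List (CounterOp Γ)} {q : Q} {w : ℕ → A} {c : Γ}

theorem exists_wReach_trace_idle (n : ℕ) :
    WReach (traceEdge next ops c) (traceStart q) w n 0 (some (detRun next q w n, none)) := by
  induction n with
  | zero => exact .init ⟨none, rfl⟩
  | succ n ih => exact .snoc false ih ⟨rfl, rfl⟩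

variable [DecidableEq Γ]

theorem WReach.trace_sound {n k : ℕ} {s : Option (Q × Option Γ)}
    (h : WReach (traceEdge next ops c) (traceStart q) w n k s) {q' : Q} {o : Option Γ}
    (hs : s = some (q', o)) : q' = detRun next q w n ∧
      match o with
      | none => k = 0
      | some d => k ≤ ctrRun next ops q w n d := by
  induction h generalizing q' o with
  | init h =>
    obtain ⟨o', rfl⟩ := h
    simp only [Option.some.injEq, Prod.mk.injEq] at hs
    obtain ⟨rfl, rfl⟩ := hs
    exact ⟨rfl, by cases o' <;> simp⟩
  | @snoc n k s s' b h hE ih =>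
    subst hs
    match s, o with
    | none, _ => exact hE.elim
    | some (p, none), o =>
      obtain ⟨rfl, rfl⟩ := hE
      obtain ⟨rfl, hk⟩ := ih rfl
      simp only at hk
      subst hk
      exact ⟨rfl, by cases o <;> simp⟩
    | some (p, some d), none => exact hE.elim
    | some (p, some d), some e =>
      obtain ⟨rfl, k', hf, hk', -⟩ := hE
      obtain ⟨rfl, hk⟩ := ih rfl
      refine ⟨rfl, ?_⟩
      have := hf.le_applyAll (ctrRun next ops q w n)
      simp only [ctrRun] at hk ⊢
      omega

/-- An edge records only whether its transition increments at all. A transition makes at most `W`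
increments, hence the factor `W`; the `+ 1` pays for a value created after a reset within one
transition. -/
theorem exists_wReach_trace {W : ℕ} (hW : ∀ q a, (ops q a).length ≤ W) (n : ℕ) (d : Γ) :
    ∃ k, WReach (traceEdge next ops c) (traceStart q) w n k (some (detRun next q w n, some d)) ∧
      ctrRun next ops q w n d ≤ W * (k + 1) := by
  induction n generalizing d with
  | zero => exact ⟨0, .init ⟨some d, rfl⟩, by simp [ctrRun]⟩
  | succ n ih =>
    have hWn := hW (detRun next q w n) (w n)
    rcases CounterOp.exists_flow (ops (detRun next q w n) (w n)) (ctrRun next ops q w n) d with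
      h | ⟨e, k, hf, hk, h⟩
    · refine ⟨0, .snoc false (exists_wReach_trace_idle n) ⟨rfl, rfl⟩, ?_⟩
      rw [ctrRun]
      omega
    · obtain ⟨k₀, hr, hv⟩ := ih e
      rcases Nat.eq_zero_or_pos k with rfl | hpos
      · exact ⟨k₀, .snoc false hr ⟨rfl, 0, hf, le_rfl, by simp⟩, h.trans hv⟩
      · refine ⟨k₀ + 1, .snoc true hr ⟨rfl, k, hf, hpos, by simp⟩, h.trans ?_⟩
        rw [mul_add _ _ 1]
        omega

theorem detBounded_iff_not_unbReach [Finite Q] [Finite A] :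
    DetBounded next ops q w c ↔
      ¬ UnbReach (traceEdge next ops c) (traceStart q) w {none} := by
  obtain ⟨W, hW⟩ : ∃ W, ∀ q a, (ops q a).length ≤ W := by
    obtain ⟨W, hW⟩ := (Set.finite_range fun p : Q × A => (ops p.1 p.2).length).bddAbove
    exact ⟨W, fun q a => hW ⟨(q, a), rfl⟩⟩
  constructor
  · rintro ⟨N, hN⟩ h
    obtain ⟨n, k, s, hk, rfl, hr⟩ := h (N + 1)
    cases hr with
    | init h => obtain ⟨_, h⟩ := h; simp at h
    | @snoc n k s _ b h hE =>
      match s with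
      | none => exact hE
      | some (_, none) => exact hE
      | some (p, some d) =>
        obtain ⟨rfl, l₁, l₂, k', hl, hf⟩ := hE
        obtain ⟨rfl, hk'⟩ := h.trace_sound rfl
        have h₁ := hN n _ (CounterOp.mem_emittedAll.2 ⟨l₁, l₂, hl, rfl⟩)
        have h₂ := hf.le_applyAll (ctrRun next ops q w n)
        simp at hk hk'
        omega
  · intro h
    simp only [UnbReach, not_forall, not_exists, not_and] at h
    obtain ⟨K, hK⟩ := h
    -- `W * (K + 1)` bounds the traced counter before the transition; the last `W` covers the
    -- increments preceding the output inside it.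
    refine ⟨W * (K + 1) + W, fun i x hx => ?_⟩
    obtain ⟨l₁, l₂, hl, rfl⟩ := CounterOp.mem_emittedAll.1 hx
    have hl₁ : l₁.length ≤ W := by
      have := hW (detRun next q w i) (w i)
      rw [hl, List.length_append] at this
      omega
    rcases CounterOp.exists_flow l₁ (ctrRun next ops q w i) c with h | ⟨d, k, hf, hk, h⟩
    · omega
    · obtain ⟨k₀, hr, hv⟩ := exists_wReach_trace (next := next) (q := q) (w := w) (c := c) hW i d
      have hlt : k₀ < K := by
        by_contra hle
        exact hK _ _ none (by simpa using hle) rfl (.snoc false hr ⟨rfl, l₁, l₂, k, hl, hf⟩)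
      have : W * (k₀ + 1) ≤ W * (K + 1) := by gcongr
      omega

end Trace

theorem IsDetMaxRecognizable.isReachDefinable {A : Type u} [Finite A] {L : Set (ℕ → A)}
    (h : IsDetMaxRecognizable L) : IsReachDefinable L := by
  obtain ⟨Q, Γ, _, _, _, M, hM, rfl⟩ := h
  obtain ⟨next, ops, h⟩ := hM.exists_functions
  have : M.language = {w | M.acc.Holds (DetBounded next ops M.start w)} := Set.ext h
  rw [this]
  refine IsReachDefinable.holds (fun c => ?_) _
  simp only [detBounded_iff_not_unbReach]
  exact (IsReachDefinable.unbReach _ _ _).compl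

/-! ## From weighted reachability to deterministic max-automata -/

namespace CounterOp

variable {Γ ι : Type} [DecidableEq Γ]

theorem applyAll_append (l₁ l₂ : List (CounterOp Γ)) (v : Γ → ℕ) :
    applyAll (l₁ ++ l₂) v = applyAll l₂ (applyAll l₁ v) := by
  induction l₁ generalizing v with
  | nil => rfl
  | cons o os ih => exact ih _

theorem emittedAll_append (c : Γ) (l₁ l₂ : List (CounterOp Γ)) (v : Γ → ℕ) :
    emittedAll c (l₁ ++ l₂) v = emittedAll c l₁ v ++ emittedAll c l₂ (applyAll l₁ v) := by
  induction l₁ generalizing v with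
  | nil => rfl
  | cons o os ih => simp [emittedAll, ih, applyAll]

theorem emittedAll_eq_nil (c : Γ) {l : List (CounterOp Γ)} (h : output c ∉ l) (v : Γ → ℕ) :
    emittedAll c l v = [] := by
  rw [List.eq_nil_iff_forall_not_mem]
  intro x hx
  obtain ⟨l₁, l₂, rfl, -⟩ := mem_emittedAll.1 hx
  simp at h

theorem applyAll_output (l : List ι) (f : ι → Γ) (v : Γ → ℕ) :
    applyAll (l.map fun i => output (f i)) v = v := by
  induction l with
  | nil => rfl
  | cons i l ih => exact ih

theorem mem_emittedAll_output {c : Γ} {l : List ι} {f : ι → Γ} {v : Γ → ℕ} {x : ℕ} :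
    x ∈ emittedAll c (l.map fun i => output (f i)) v ↔ (∃ i ∈ l, f i = c) ∧ x = v c := by
  induction l with
  | nil => simp [emittedAll]
  | cons i l ih =>
    rw [List.map_cons, emittedAll, List.mem_append, apply, ih]
    by_cases h : f i = c <;> simp [emitted, h]

theorem applyAll_reset (l : List ι) (f : ι → Γ) (v : Γ → ℕ) (c : Γ) :
    applyAll (l.map fun i => reset (f i)) v c = if c ∈ l.map f then 0 else v c := by
  induction l generalizing v with
  | nil => simp [applyAll]
  | cons i l ih =>
    rw [List.map_cons, applyAll, ih, List.map_cons]
    by_cases h : c = f i <;> simp [apply, h]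

theorem applyAll_incr (l : List ι) (f : ι → Γ) (hl : (l.map f).Nodup) (v : Γ → ℕ) (c : Γ) :
    applyAll (l.map fun i => incr (f i)) v c = if c ∈ l.map f then v c + 1 else v c := by
  induction l generalizing v with
  | nil => simp [applyAll]
  | cons i l ih =>
    rw [List.map_cons, List.nodup_cons] at hl
    rw [List.map_cons, applyAll, ih hl.2, List.map_cons]
    by_cases h : c = f i
    · subst h
      rw [if_neg hl.1]
      simp [apply]
    · simp [apply, h]

/-- No source of a maximum is also a target, so the operations do not influence one another and act
as if simultaneous. -/
theorem le_applyAll_max (l : List ι) (f g : ι → Γ) (h : ∀ i ∈ l, ∀ j ∈ l, g i ≠ f j) (v : Γ → ℕ)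
    (c : Γ) (k : ℕ) : k ≤ applyAll (l.map fun i => max (f i) (g i)) v c ↔
      k ≤ v c ∨ ∃ i ∈ l, f i = c ∧ k ≤ v (g i) := by
  induction l generalizing v with
  | nil => simp [applyAll]
  | cons i l ih =>
    rw [List.map_cons, applyAll, ih fun i hi j hj => h i (by simp [hi]) j (by simp [hj])]
    have hg : ∀ j ∈ l, (apply (.max (f i) (g i)) v) (g j) = v (g j) := fun j hj =>
      Function.update_of_ne (h j (by simp [hj]) i (by simp)) _ _
    have hl : (∃ j ∈ l, f j = c ∧ k ≤ (apply (.max (f i) (g i)) v) (g j)) ↔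
        ∃ j ∈ l, f j = c ∧ k ≤ v (g j) :=
      exists_congr fun j => and_congr_right fun hj => by rw [hg j hj]
    rw [hl]
    by_cases hc : c = f i
    · subst hc
      simp [apply, or_assoc]
    · simp [apply, hc, Ne.symm hc]

end CounterOp

section MaxPlus

open CounterOp Classical

variable {A : Type u} {σ : Type} [Fintype σ]

/-- The edges with letter `a` and weight `b` that leave `R`. -/
noncomputable def edgeList (E : σ → A → Bool → σ → Prop) (R : Set σ) (a : A) (b : Bool) :
    List (σ × σ) :=
  (Finset.univ.filter fun p : σ × σ => p.1 ∈ R ∧ E p.1 a b p.2).toList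

theorem mem_edgeList {E : σ → A → Bool → σ → Prop} {R : Set σ} {a : A} {b : Bool} {p : σ × σ} :
    p ∈ edgeList E R a b ↔ p.1 ∈ R ∧ E p.1 a b p.2 := by
  simp [edgeList]

/-- Operations that store in `inl s`, for the states `s` that can be reached, the maximal weight
of a path to `s`. The counters `inr s` hold intermediate results. -/
noncomputable def updateOps (E : σ → A → Bool → σ → Prop) (R : Set σ) (a : A) :
    List (CounterOp (σ ⊕ σ)) :=
  (Finset.univ.toList.map fun s : σ => reset (Sum.inr s)) ++
  ((edgeList E R a false).map fun p => max (Sum.inr p.2) (Sum.inl p.1)) ++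
  (Finset.univ.toList.map fun s : σ => incr (Sum.inl s)) ++
  ((edgeList E R a true).map fun p => max (Sum.inr p.2) (Sum.inl p.1)) ++
  (Finset.univ.toList.map fun s : σ => reset (Sum.inl s)) ++
  (Finset.univ.toList.map fun s : σ => max (Sum.inl s) (Sum.inr s))

/-- The old `inl` values are still being read, so new maxima are collected in `inr`: edges of weight
0 before all `inl` counters are incremented, edges of weight 1 after that, then everything is copied
back. The form `k ≤ _` turns a maximum over possibly no edges into a disjunction. -/
theorem le_applyAll_updateOps (E : σ → A → Bool → σ → Prop) (R : Set σ) (a : A)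
    (v : σ ⊕ σ → ℕ) (s' : σ) (k : ℕ) :
    k ≤ applyAll (updateOps E R a) v (.inl s') ↔
      k = 0 ∨ ∃ s ∈ R, ∃ b, E s a b s' ∧ k ≤ v (.inl s) + b.toNat := by
  simp only [updateOps, applyAll_append]
  rw [le_applyAll_max _ _ _ (by simp), applyAll_reset, if_pos (by simp)]
  set v₁ := applyAll (Finset.univ.toList.map fun s : σ => reset (Sum.inr s)) v with hv₁
  set v₂ := applyAll ((edgeList E R a false).map fun p => max (Sum.inr p.2) (Sum.inl p.1)) v₁
    with hv₂
  set v₃ := applyAll (Finset.univ.toList.map fun s : σ => incr (Sum.inl s)) v₂ with hv₃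
  have h₁l : ∀ s, v₁ (.inl s) = v (.inl s) := fun s => by rw [hv₁, applyAll_reset]; simp
  have h₁r : ∀ s, v₁ (.inr s) = 0 := fun s => by rw [hv₁, applyAll_reset]; simp
  have h₂l : ∀ s, v₂ (.inl s) = v (.inl s) := fun s => by
    refine eq_of_forall_le_iff fun k => ?_
    rw [hv₂, le_applyAll_max _ _ _ (by simp), h₁l]
    simp
  have h₂r : ∀ s' k, k ≤ v₂ (.inr s') ↔
      k = 0 ∨ ∃ s ∈ R, E s a false s' ∧ k ≤ v (.inl s) := fun s' k => by
    rw [hv₂, le_applyAll_max _ _ _ (by simp), h₁r]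
    simp [mem_edgeList, h₁l, and_assoc]
  have hnd : (Finset.univ.toList.map (Sum.inl : σ → σ ⊕ σ)).Nodup :=
    (Finset.nodup_toList _).map Sum.inl_injective
  have h₃l : ∀ s, v₃ (.inl s) = v (.inl s) + 1 := fun s => by
    rw [hv₃, applyAll_incr _ _ hnd, if_pos (by simp), h₂l]
  have h₃r : ∀ s, v₃ (.inr s) = v₂ (.inr s) := fun s => by
    rw [hv₃, applyAll_incr _ _ hnd, if_neg (by simp)]
  have h₄ : ∀ s' k, k ≤ applyAll ((edgeList E R a true).map fun p =>
      max (Sum.inr p.2) (Sum.inl p.1)) v₃ (.inr s') ↔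
      (k = 0 ∨ ∃ s ∈ R, E s a false s' ∧ k ≤ v (.inl s)) ∨
        ∃ s ∈ R, E s a true s' ∧ k ≤ v (.inl s) + 1 := fun s' k => by
    rw [le_applyAll_max _ _ _ (by simp), h₃r, h₂r]
    simp [mem_edgeList, h₃l, and_assoc]
  have h₅ : ∀ s u, applyAll (Finset.univ.toList.map fun s : σ => reset (Sum.inl s)) u
      (.inr s : σ ⊕ σ) = u (.inr s) := fun s u => by rw [applyAll_reset]; simp
  simp only [h₅, h₄, Finset.mem_toList, Finset.mem_univ, true_and, Sum.inl.injEq, exists_eq_left,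
    Nat.le_zero, Bool.exists_bool, Bool.toNat_false, Bool.toNat_true, add_zero, and_or_left,
    exists_or, or_assoc, or_self_left]

/-- An unreached state holds the default 0, indistinguishable from weight 0. Its counter is not
output, so every output is the weight of a path. -/
noncomputable def reachOps (E : σ → A → Bool → σ → Prop) (R : Set σ) (a : A) :
    List (CounterOp (σ ⊕ σ)) :=
  updateOps E R a ++
    ((Finset.univ.filter fun s => s ∈ succSet E R a).toList.map fun s => output (Sum.inl s))

theorem mem_emittedAll_reachOps {E : σ → A → Bool → σ → Prop} {R : Set σ} {a : A}
    {v : σ ⊕ σ → ℕ} {s : σ} {x : ℕ} : x ∈ emittedAll (.inl s) (reachOps E R a) v ↔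
      s ∈ succSet E R a ∧ x = applyAll (reachOps E R a) v (.inl s) := by
  rw [reachOps, emittedAll_append, emittedAll_eq_nil _ (by simp [updateOps]), List.nil_append,
    mem_emittedAll_output, applyAll_append, applyAll_output]
  simp

variable {E : σ → A → Bool → σ → Prop} {T : Set σ} {w : ℕ → A}

/-- For `k = 0` the left side says nothing; there `hs` supplies the path. -/
theorem le_ctrRun_reachOps {n : ℕ} {s : σ} (hs : s ∈ detRun (succSet E) T w n) (k : ℕ) :
    k ≤ ctrRun (succSet E) (reachOps E) T w n (.inl s) ↔
      ∃ k', k ≤ k' ∧ WReach E T w n k' s := by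
  induction n generalizing s k with
  | zero =>
    simp only [ctrRun, wReach_zero]
    constructor
    · exact fun h => ⟨0, h, rfl, hs⟩
    · rintro ⟨_, h, rfl, -⟩
      exact h
  | succ n ih =>
    rw [ctrRun, reachOps, applyAll_append, applyAll_output, le_applyAll_updateOps]
    constructor
    · rintro (rfl | ⟨s₀, hs₀, b, hE, hk⟩)
      · obtain ⟨k', h⟩ := mem_detRun_succSet.1 hs
        exact ⟨k', k'.zero_le, h⟩
      · obtain ⟨k', hk', hr⟩ := (ih hs₀ (k - b.toNat)).1 (by omega)
        exact ⟨k' + b.toNat, by omega, .snoc b hr hE⟩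
    · rintro ⟨k', hk, h⟩
      obtain ⟨k₀, s₀, b, hr, hE, rfl⟩ := wReach_succ.1 h
      have hs₀ := mem_detRun_succSet.2 ⟨k₀, hr⟩
      have := (ih hs₀ k₀).2 ⟨k₀, le_rfl, hr⟩
      exact .inr ⟨s₀, hs₀, b, hE, by omega⟩

theorem detBounded_reachOps_iff (s : σ) :
    DetBounded (succSet E) (reachOps E) T w (.inl s) ↔ ¬ UnbReach E T w {s} := by
  simp only [DetBounded, mem_emittedAll_reachOps, UnbReach, Set.mem_singleton_iff]
  constructor
  · rintro ⟨N, hN⟩ h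
    obtain ⟨n, k, s, hk, rfl, hr⟩ := h (N + 1)
    -- Outputs happen only while reading a letter, so the empty path is excluded by its weight 0.
    obtain _ | n := n
    · have := hr.le
      omega
    · have hs := mem_detRun_succSet.2 ⟨k, hr⟩
      have h₁ := hN n _ ⟨hs, rfl⟩
      have h₂ := (le_ctrRun_reachOps hs k).2 ⟨k, le_rfl, hr⟩
      rw [ctrRun] at h₂
      omega
  · intro h
    push Not at h
    obtain ⟨K, hK⟩ := h
    refine ⟨K, fun i v ⟨hs, hv⟩ => ?_⟩
    by_contra hlt
    obtain ⟨k', hk, hr⟩ := (le_ctrRun_reachOps (n := i + 1) hs K).1 (by rw [ctrRun]; omega)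
    exact hK _ _ s hk rfl hr

end MaxPlus

theorem IsReachDefinable.isDetMaxRecognizable {A : Type u} [Finite A] {L : Set (ℕ → A)}
    (h : IsReachDefinable L) : IsDetMaxRecognizable L := by
  classical
  obtain ⟨σ, _, E, T, α, h⟩ := h
  have := Fintype.ofFinite σ
  refine isDetMaxRecognizable_of_functions (succSet E) (reachOps E) T (α.map Sum.inl) fun w => ?_
  rw [h, BoundCond.holds_map]
  exact BoundCond.holds_congr (fun s => (detBounded_reachOps_iff s).symm) _

theorem isReachDefinable_iff {A : Type u} [Finite A] {L : Set (ℕ → A)} :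
    IsReachDefinable L ↔ IsDetMaxRecognizable L :=
  ⟨IsReachDefinable.isDetMaxRecognizable, IsDetMaxRecognizable.isReachDefinable⟩

/-! ## Tracking all runs of a deterministic automaton in finitely many slots -/

section Slots

variable {A : Type u} {J Q : Type} [LinearOrder J]

/-- The run in slot `j` merges with the run in a smaller slot when `a` is read. -/
def Merges (f : Q → A → Q) (π : J ≃ Q) (a : A) (j : J) : Prop :=
  ∃ i < j, f (π i) a = f (π j) a

/-- Of two slots with the same successor the larger one merges, so successors are injective on the
non-merging slots, and a partial injection between sets of equal size extends to a bijection. -/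
theorem exists_slots_extend [Finite J] (f : Q → A → Q) (π : J ≃ Q) (a : A) :
    ∃ π' : J ≃ Q, ∀ j, ¬ Merges f π a j → π' j = f (π j) a := by
  classical
  have := Fintype.ofFinite J
  have : Fintype Q := Fintype.ofEquiv J π
  obtain ⟨g, hg⟩ := Finset.exists_equiv_extend_of_card_eq (t := (Finset.univ : Finset Q))
    (Fintype.card_congr π) (s := Finset.univ.filter fun j => ¬ Merges f π a j)
    (f := fun j => f (π j) a) (Finset.subset_univ _) (by
      intro i hi j hj hij
      simp only [Finset.coe_filter, Finset.mem_univ, true_and, Set.mem_ofPred_eq] at hi hj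
      rcases lt_trichotomy i j with h | h | h
      · exact (hj ⟨i, h, hij⟩).elim
      · exact h
      · exact (hi ⟨j, h, hij.symm⟩).elim)
  exact ⟨g.trans (Equiv.subtypeUnivEquiv (by simp)), fun j hj => hg j (by simpa using hj)⟩

variable [Finite J]

/-- The assignment of states to slots after reading `a`: the slots that do not merge follow their
run, the other slots are reused. -/
noncomputable def nextSlots (f : Q → A → Q) (π : J ≃ Q) (a : A) : J ≃ Q :=
  (exists_slots_extend f π a).choose

theorem nextSlots_apply {f : Q → A → Q} {π : J ≃ Q} {a : A} {j : J} (h : ¬ Merges f π a j) :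
    nextSlots f π a j = f (π j) a :=
  (exists_slots_extend f π a).choose_spec j h

variable {f : Q → A → Q} {e : J ≃ Q} {w : ℕ → A}

theorem detRun_nextSlots_add {n : ℕ} {j : J}
    (h : ∀ m ≥ n, ¬ Merges f (detRun (nextSlots f) e w m) (w m) j) (m : ℕ) :
    detRun (nextSlots f) e w (n + m) j =
      detRun f (detRun (nextSlots f) e w n j) (fun i => w (n + i)) m := by
  induction m with
  | zero => rfl
  | succ m ih => rw [← add_assoc, detRun, nextSlots_apply (h _ (by omega)), ih, detRun]

/-- The slot of the run never increases and drops strictly at each merge. With finitely many slots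
it becomes constant, and from then on it does not merge. -/
theorem exists_slot_of_run {r : ℕ → Q} {n : ℕ} (hr : ∀ m ≥ n, r (m + 1) = f (r m) (w m)) :
    ∃ j : J, ∃ n₀ ≥ n, ∀ m ≥ n₀, r m = detRun (nextSlots f) e w m j ∧
      ¬ Merges f (detRun (nextSlots f) e w m) (w m) j := by
  set π := detRun (nextSlots f) e w with hπ
  set slot : ℕ → J := fun m => (π m).symm (r m) with hslot
  have hs : ∀ m, π m (slot m) = r m := fun m => by simp [hslot]
  have hstep : ∀ m ≥ n, slot (m + 1) ≤ slot m ∧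
      (Merges f (π m) (w m) (slot m) → slot (m + 1) < slot m) := by
    intro m hm
    -- The least slot with the same successor does not merge, so it carries the run after this
    -- letter.
    obtain ⟨i, hi, hmin⟩ := (wellFounded_lt (α := J)).has_min
      {i | f (π m i) (w m) = f (π m (slot m)) (w m)} ⟨slot m, rfl⟩
    have hni : ¬ Merges f (π m) (w m) i := fun ⟨i', hlt, heq⟩ => hmin i' (heq.trans hi) hlt
    have hsi : slot (m + 1) = i := by
      rw [hslot]
      simp only
      rw [Equiv.symm_apply_eq, hr m hm, ← hs m]
      exact hi.symm.trans (nextSlots_apply hni).symm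
    rw [hsi]
    refine ⟨not_lt.1 (hmin _ rfl), fun hmerge => ?_⟩
    refine lt_of_le_of_ne (not_lt.1 (hmin _ rfl)) fun h => hni (h ▸ hmerge)
  obtain ⟨n₀, hn₀⟩ := WellFoundedGT.monotone_chain_condition
    (⟨fun m => OrderDual.toDual (slot (n + m)),
      monotone_nat_of_le_succ fun m => (hstep (n + m) (by omega)).1⟩ : ℕ →o Jᵒᵈ)
  have hconst : ∀ m ≥ n + n₀, slot m = slot (n + n₀) := by
    intro m hm
    obtain ⟨d, rfl⟩ := Nat.exists_eq_add_of_le hm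
    rw [add_assoc]
    exact (hn₀ (n₀ + d) (by omega)).symm
  refine ⟨slot (n + n₀), n + n₀, by omega, fun m hm => ⟨?_, fun hmerge => ?_⟩⟩
  · rw [← hconst m hm, hs]
  · rw [← hconst m hm] at hmerge
    have := (hstep m (by omega)).2 hmerge
    rw [hconst m hm, hconst (m + 1) (by omega)] at this
    exact this.false

/-! ### Infinitely many merges -/

/-- Weight 1 is permitted, not forced, at a merge of slot `j`, so paths count some of the merges. -/
def mergeEdge (f : Q → A → Q) (j : J) (π : J ≃ Q) (a : A) (b : Bool) (π' : J ≃ Q) : Prop :=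
  π' = nextSlots f π a ∧ (b = true → Merges f π a j)

theorem unbReach_mergeEdge_iff {j : J} : UnbReach (mergeEdge f j) {e} w Set.univ ↔
    ∀ N, ∃ n ≥ N, Merges f (detRun (nextSlots f) e w n) (w n) j := by
  constructor
  · intro h N
    by_contra! hc
    have key : ∀ {n k π}, WReach (mergeEdge f j) {e} w n k π →
        π = detRun (nextSlots f) e w n ∧ k ≤ N := by
      intro n k π h
      -- The extra invariant `k ≤ n` keeps the weight at most `N` when a merge is counted, which
      -- happens only at times `n < N`.
      suffices π = detRun (nextSlots f) e w n ∧ k ≤ N ∧ k ≤ n from ⟨this.1, this.2.1⟩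
      induction h with
      | init h => exact ⟨h, by simp, by simp⟩
      | @snoc n k π π' b h hE ih =>
        obtain ⟨rfl, hkN, hkn⟩ := ih
        refine ⟨hE.1, ?_⟩
        cases b with
        | false => simp; omega
        | true =>
          have : n < N := by
            by_contra hle
            exact hc n (by omega) (hE.2 rfl)
          simp; omega
    obtain ⟨n, k, π, hk, -, hr⟩ := h (N + 1)
    have := (key hr).2
    omega
  · intro h k
    have idle : ∀ {n k}, WReach (mergeEdge f j) {e} w n k (detRun (nextSlots f) e w n) →
        ∀ d, WReach (mergeEdge f j) {e} w (n + d) k (detRun (nextSlots f) e w (n + d)) := by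
      intro n k h d
      induction d with
      | zero => exact h
      | succ d ih => exact .snoc false ih ⟨rfl, by simp⟩
    have key : ∀ k, ∃ n, WReach (mergeEdge f j) {e} w n k (detRun (nextSlots f) e w n) := by
      intro k
      induction k with
      | zero => exact ⟨0, .init rfl⟩
      | succ k ih =>
        obtain ⟨n, hr⟩ := ih
        obtain ⟨m, hm, hmerge⟩ := h n
        obtain ⟨d, rfl⟩ := Nat.exists_eq_add_of_le hm
        exact ⟨n + d + 1, .snoc true (idle hr d) ⟨rfl, fun _ => hmerge⟩⟩
    obtain ⟨n, hr⟩ := key k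
    exact ⟨n, k, _, le_rfl, trivial, hr⟩

end Slots

/-! ## Quantification over finite sets -/

theorem card_filter_range_succ (Y : Finset ℕ) (n : ℕ) :
    ((Finset.range (n + 1)).filter (· ∈ Y)).card =
      ((Finset.range n).filter (· ∈ Y)).card + (decide (n ∈ Y)).toNat := by
  rw [Finset.range_add_one, Finset.filter_insert]
  split_ifs with hn <;> simp [hn]

theorem exists_finset_extend {n : ℕ} {X : Finset ℕ} (hX : X ⊆ Finset.range n) (c : Bool) :
    ∃ X' : Finset ℕ, X' ⊆ Finset.range (n + 1) ∧ X'.card = X.card + c.toNat ∧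
      decide (n ∈ X') = c ∧ ∀ i, i ≠ n → (i ∈ X' ↔ i ∈ X) := by
  have hn : n ∉ X := fun h => by simpa using hX h
  have hX' : X ⊆ Finset.range (n + 1) := hX.trans (Finset.range_mono (by omega))
  cases c with
  | false => exact ⟨X, hX', by simp, by simpa using hn, fun _ _ => Iff.rfl⟩
  | true =>
    exact ⟨insert n X, Finset.insert_subset (by simp) hX', by simp [hn], by simp,
      fun i hi => by simp [hi]⟩

section Quantification

variable {A : Type u} {J σ : Type} [LinearOrder J] [Finite J]
  {E : σ → A × Bool → Bool → σ → Prop}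

/-- The transition function on sets of states along unmarked positions. -/
def unmarkedSucc (E : σ → A × Bool → Bool → σ → Prop) (R : Set σ) (a : A) : Set σ :=
  succSet E R (a, false)

theorem detRun_unmarkedSucc (R : Set σ) (w : ℕ → A) (n : ℕ) :
    detRun (unmarkedSucc E) R w n = detRun (succSet E) R (fun i => (w i, false)) n := by
  induction n with
  | zero => rfl
  | succ n ih => rw [detRun, ih, detRun, unmarkedSucc]

/-- The graph that waits, chooses a state from the set in slot `j`, and then follows the edges of
`E` along unmarked positions until slot `j` merges. -/
def slotEdge (E : σ → A × Bool → Bool → σ → Prop) (j : J) :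
    (J ≃ Set σ) × Option σ → A → Bool → (J ≃ Set σ) × Option σ → Prop
  | (π, o), a, b, (π', o') => π' = nextSlots (unmarkedSucc E) π a ∧
    match o, o' with
    | none, none => b = false
    | none, some s' => b = false ∧ s' ∈ π' j
    | some s, some s' => ¬ Merges (unmarkedSucc E) π a j ∧ E s (a, false) b s'
    | some _, none => False

variable {e : J ≃ Set σ} {w : ℕ → A} {j : J}

/-- From `n₀` on, slot `j` follows a genuine unmarked run. A path that chose its state earlier is
cut at `n₀`, losing at most `n₀` of weight; a state chosen later is reachable from the content of
the slot at `n₀`. -/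
theorem WReach.slotEdge_sound {n₀ : ℕ} (h₀ : ∀ m ≥ n₀,
      ¬ Merges (unmarkedSucc E) (detRun (nextSlots (unmarkedSucc E)) e w m) (w m) j)
    {n k : ℕ} {p : (J ≃ Set σ) × Option σ} (h : WReach (slotEdge E j) {(e, none)} w n k p) :
    p.1 = detRun (nextSlots (unmarkedSucc E)) e w n ∧ (p.2 = none → k = 0) ∧
      ∀ s, p.2 = some s → s ∈ p.1 j ∧ ∀ m, n = n₀ + m → ∃ k', k ≤ k' + n₀ ∧
        WReach E (detRun (nextSlots (unmarkedSucc E)) e w n₀ j)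
          (fun i => (w (n₀ + i), false)) m k' s := by
  have start : ∀ {m s}, s ∈ detRun (nextSlots (unmarkedSucc E)) e w (n₀ + m) j →
      ∃ k', WReach E (detRun (nextSlots (unmarkedSucc E)) e w n₀ j)
        (fun i => (w (n₀ + i), false)) m k' s := by
    intro m s hs
    rw [detRun_nextSlots_add h₀, detRun_unmarkedSucc] at hs
    exact mem_detRun_succSet.1 hs
  induction h with
  | init h =>
    rw [Set.mem_singleton_iff] at h
    subst h
    exact ⟨rfl, fun _ => rfl, by simp⟩
  | @snoc n k p p' b h hE ih =>
    obtain ⟨π, o⟩ := p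
    obtain ⟨π', o'⟩ := p'
    obtain ⟨rfl, hE⟩ := hE
    obtain ⟨hπ, hnone, hsome⟩ := ih
    simp only at hπ hnone hsome
    subst hπ
    refine ⟨rfl, ?_⟩
    match o, o', hE with
    | none, none, hE => exact ⟨fun _ => by simp [hnone rfl, hE], by simp⟩
    | none, some s', ⟨hb, hs'⟩ =>
      refine ⟨by simp, ?_⟩
      rintro s ⟨⟩
      refine ⟨hs', fun m hm => ?_⟩
      obtain ⟨k', hk'⟩ := start (m := m) (s := s') (by rw [← hm]; exact hs')
      exact ⟨k', by simp [hnone rfl, hb], hk'⟩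
    | some s, some s', ⟨hmerge, hE⟩ =>
      refine ⟨by simp, ?_⟩
      rintro s'' ⟨⟩
      obtain ⟨hs, hrun⟩ := hsome s rfl
      have hs' : s' ∈ nextSlots (unmarkedSucc E)
          (detRun (nextSlots (unmarkedSucc E)) e w n) (w n) j := by
        rw [nextSlots_apply hmerge]
        exact ⟨s, hs, b, hE⟩
      refine ⟨hs', fun m hm => ?_⟩
      have hk := (h.snoc (s' := (nextSlots (unmarkedSucc E)
          (detRun (nextSlots (unmarkedSucc E)) e w n) (w n), some s')) b ⟨rfl, hmerge, hE⟩).le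
      obtain _ | m := m
      · exact ⟨0, by omega, .init (by rw [← add_zero n₀, ← hm]; exact hs')⟩
      · obtain rfl : n = n₀ + m := by omega
        obtain ⟨k', hk', hr⟩ := hrun m rfl
        exact ⟨_, by omega, .snoc b hr hE⟩

theorem unbReach_slotEdge_iff {n₀ : ℕ} (hpos : 0 < n₀) (h₀ : ∀ m ≥ n₀,
      ¬ Merges (unmarkedSucc E) (detRun (nextSlots (unmarkedSucc E)) e w m) (w m) j) (q : σ) :
    UnbReach (slotEdge E j) {(e, none)} w {p | p.2 = some q} ↔
      UnbReach E (detRun (nextSlots (unmarkedSucc E)) e w n₀ j)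
        (fun i => (w (n₀ + i), false)) {q} := by
  constructor
  · intro h k
    obtain ⟨n, k', p, hk, hp, hr⟩ := h (k + n₀)
    have := hr.le
    obtain ⟨m, rfl⟩ := Nat.exists_eq_add_of_le (show n₀ ≤ n by omega)
    obtain ⟨k'', hk'', hr'⟩ := ((hr.slotEdge_sound h₀).2.2 q hp).2 m rfl
    exact ⟨m, k'', q, by omega, rfl, hr'⟩
  · intro h k
    have idle : ∀ n, WReach (slotEdge E j) {(e, none)} w n 0
        (detRun (nextSlots (unmarkedSucc E)) e w n, none) := by
      intro n
      induction n with
      | zero => exact .init rfl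
      | succ n ih => exact .snoc false ih ⟨rfl, rfl⟩
    have key : ∀ {m k s}, WReach E (detRun (nextSlots (unmarkedSucc E)) e w n₀ j)
        (fun i => (w (n₀ + i), false)) m k s → WReach (slotEdge E j) {(e, none)} w (n₀ + m) k
          (detRun (nextSlots (unmarkedSucc E)) e w (n₀ + m), some s) := by
      intro m k s h
      induction h with
      | init h =>
        -- Choosing a state uses an edge, taken on the letter just before `n₀`; this is why `n₀`
        -- must be positive.
        obtain ⟨n, rfl⟩ := Nat.exists_eq_succ_of_ne_zero hpos.ne'
        exact .snoc false (idle n) ⟨rfl, rfl, h⟩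
      | @snoc m k s s' b h hE ih => exact .snoc b ih ⟨rfl, h₀ _ (by omega), hE⟩
    obtain ⟨m, k', s, hk, rfl, hr⟩ := h k
    exact ⟨_, k', _, hk, rfl, key hr⟩

/-- The graph that guesses markings `c` and weights `b` related by `ok`, and keeps the set of
states reached so far. -/
def guessEdge (E : σ → A × Bool → Bool → σ → Prop) (ok : Bool → Bool → Prop) :
    Set σ × (J ≃ Set σ) → A → Bool → Set σ × (J ≃ Set σ) → Prop
  | (R, π), a, b, (R', π') => π' = nextSlots (unmarkedSucc E) π a ∧
    ∃ c, ok c b ∧ R' = succSet E R (a, c)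

variable {ok : Bool → Bool → Prop} {T : Set σ}

theorem wReach_guessEdge (X Y : Finset ℕ) (h : ∀ i, ok (decide (i ∈ X)) (decide (i ∈ Y)))
    (n : ℕ) : WReach (guessEdge E ok) {(T, e)} w n ((Finset.range n).filter (· ∈ Y)).card
      (detRun (succSet E) T (annotate w X) n, detRun (nextSlots (unmarkedSucc E)) e w n) := by
  induction n with
  | zero => exact .init rfl
  | succ n ih =>
    rw [card_filter_range_succ]
    exact .snoc _ ih ⟨rfl, _, h n, rfl⟩

/-- The bits guessed along the path spell out `X` and `Y`; `hok` handles the positions not yet read.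
-/
theorem WReach.exists_of_guessEdge (hok : ok false false) {n k : ℕ} {p : Set σ × (J ≃ Set σ)}
    (h : WReach (guessEdge E ok) {(T, e)} w n k p) :
    p.2 = detRun (nextSlots (unmarkedSucc E)) e w n ∧ ∃ X Y : Finset ℕ,
      X ⊆ Finset.range n ∧ Y ⊆ Finset.range n ∧ Y.card = k ∧
      (∀ i, ok (decide (i ∈ X)) (decide (i ∈ Y))) ∧
      p.1 = detRun (succSet E) T (annotate w X) n := by
  induction h with
  | init h =>
    rw [Set.mem_singleton_iff] at h
    subst h
    exact ⟨rfl, ∅, ∅, by simp, by simp, rfl, by simpa using hok, rfl⟩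
  | @snoc n k p p' b h hE ih =>
    obtain ⟨R, π⟩ := p
    obtain ⟨R', π'⟩ := p'
    obtain ⟨hπ, X, Y, hX, hY, rfl, hXY, hR⟩ := ih
    simp only at hπ hR
    subst hπ hR
    obtain ⟨rfl, c, hcb, rfl⟩ := hE
    obtain ⟨X', hX', -, hXn, hXi⟩ := exists_finset_extend hX c
    obtain ⟨Y', hY', hcard, hYn, hYi⟩ := exists_finset_extend hY b
    refine ⟨rfl, X', Y', hX', hY', hcard, fun i => ?_, ?_⟩
    · by_cases hi : i = n
      · subst hi
        rwa [hXn, hYn]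
      · simpa only [hXi i hi, hYi i hi] using hXY i
    · rw [detRun, annotate, hXn]
      refine congrArg (fun R => succSet E R (w n, c)) (detRun_congr _ _ fun i hi => ?_)
      simp only [annotate, hXi i hi.ne]

theorem unbReach_guessEdge_iff (hok : ok false false) :
    UnbReach (guessEdge E ok) {(T, e)} w {p | p.1 = p.2 j} ↔
      ∀ k, ∃ n, ∃ X Y : Finset ℕ, X ⊆ Finset.range n ∧ Y ⊆ Finset.range n ∧ k ≤ Y.card ∧
        (∀ i, ok (decide (i ∈ X)) (decide (i ∈ Y))) ∧
        detRun (succSet E) T (annotate w X) n = detRun (nextSlots (unmarkedSucc E)) e w n j := by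
  refine forall_congr' fun k => exists_congr fun n => ?_
  constructor
  · rintro ⟨k', p, hk, hp, hr⟩
    obtain ⟨hπ, X, Y, hX, hY, rfl, hXY, hR⟩ := hr.exists_of_guessEdge hok
    exact ⟨X, Y, hX, hY, hk, hXY, by rw [← hR, ← hπ]; exact hp⟩
  · rintro ⟨X, Y, hX, hY, hk, hXY, h⟩
    refine ⟨_, _, ?_, ?_, wReach_guessEdge X Y hXY n⟩
    · rwa [Finset.filter_mem_eq_inter, Finset.inter_eq_right.2 hY]
    · exact h

end Quantification

/-- The languages in the class are closed under quantification over a finite set `X` together with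
arbitrarily large finite sets `Y` related to `X` by a letterwise relation. -/
theorem IsReachDefinable.quantify {A : Type u} (ok : Bool → Bool → Prop) (hok : ok false false)
    {L : Set (ℕ → A × Bool)} (hL : IsReachDefinable L) :
    IsReachDefinable {w : ℕ → A | ∀ k, ∃ X Y : Finset ℕ, k ≤ Y.card ∧
      (∀ i, ok (decide (i ∈ X)) (decide (i ∈ Y))) ∧ annotate w X ∈ L} := by
  obtain ⟨σ, _, E, T, α, hL⟩ := hL
  obtain ⟨N, ⟨e'⟩⟩ := Finite.exists_equiv_fin (Set σ)
  let e := e'.symm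
  -- For a slot `j`: it merges finitely often, arbitrarily large `Y` come with an `X` whose run is
  -- in slot `j`, and the acceptance condition holds along slot `j`.
  have hset : {w : ℕ → A | ∀ k, ∃ X Y : Finset ℕ, k ≤ Y.card ∧
      (∀ i, ok (decide (i ∈ X)) (decide (i ∈ Y))) ∧ annotate w X ∈ L} =
      ⋃ j : Fin N, {w | UnbReach (mergeEdge (unmarkedSucc E) j) {e} w Set.univ}ᶜ ∩
        ({w | UnbReach (guessEdge E ok) {(T, e)} w {p | p.1 = p.2 j}} ∩
        {w | α.Holds fun q => ¬ UnbReach (slotEdge E j) {(e, none)} w {p | p.2 = some q}}) := by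
    ext w
    have hmem : ∀ {n : ℕ} {X : Finset ℕ}, X ⊆ Finset.range n → (annotate w X ∈ L ↔
        α.Holds fun q => ¬ UnbReach E (detRun (succSet E) T (annotate w X) n)
          (fun i => (w (n + i), false)) {q}) := by
      intro n X hX
      rw [hL]
      refine BoundCond.holds_congr (fun q => not_congr ?_) _
      rw [unbReach_suffix n]
      have : (fun i => annotate w X (n + i)) = fun i => (w (n + i), false) := by
        funext i
        have : n + i ∉ X := fun h => by simpa using hX h
        simp [annotate, this]
      rw [this]
    simp only [Set.mem_ofPred_eq, Set.mem_iUnion, Set.mem_inter_iff, Set.mem_compl_iff,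
      unbReach_mergeEdge_iff, unbReach_guessEdge_iff hok]
    set π := detRun (nextSlots (unmarkedSucc E)) e w with hπ
    constructor
    · intro h
      -- Different `k` may lead to different slots; pigeonhole selects one slot that serves all `k`.
      obtain ⟨j, hj⟩ := exists_uniform_of_antitone (P := fun (j : Fin N) k =>
        ∃ n₀ > 0, (∀ m ≥ n₀, ¬ Merges (unmarkedSucc E) (π m) (w m) j) ∧
          ∃ X Y : Finset ℕ, X ⊆ Finset.range n₀ ∧ Y ⊆ Finset.range n₀ ∧ k ≤ Y.card ∧
            (∀ i, ok (decide (i ∈ X)) (decide (i ∈ Y))) ∧ annotate w X ∈ L ∧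
            detRun (succSet E) T (annotate w X) n₀ = π n₀ j)
        (fun j k l hkl ⟨n₀, h₁, h₂, X, Y, h₃, h₄, h₅, h₆⟩ =>
          ⟨n₀, h₁, h₂, X, Y, h₃, h₄, hkl.trans h₅, h₆⟩)
        (fun k => by
          obtain ⟨X, Y, hk, hXY, hXL⟩ := h k
          obtain ⟨n, hn⟩ : ∃ n, X ∪ Y ⊆ Finset.range n :=
            Finset.exists_nat_subset_range (X ∪ Y)
          -- Starting at `n + 1` instead of `n` makes `n₀` positive.
          obtain ⟨j, n₀, hn₀, hj⟩ := exists_slot_of_run (J := Fin N) (e := e) (w := w)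
            (f := unmarkedSucc E) (r := detRun (succSet E) T (annotate w X)) (n := n + 1)
            (fun m hm => by
              have : m ∉ X := fun h => by
                have := hn (Finset.mem_union_left _ h)
                simp at this
                omega
              rw [detRun]
              simp [annotate, this, unmarkedSucc])
          have hsub : X ∪ Y ⊆ Finset.range n₀ := hn.trans (Finset.range_mono (by omega))
          exact ⟨j, n₀, by omega, fun m hm => (hj m hm).2, X, Y,
            Finset.union_subset_left hsub, Finset.union_subset_right hsub, hk, hXY, hXL,
            (hj n₀ le_rfl).1⟩)
      refine ⟨j, ?_, fun k => ?_, ?_⟩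
      · obtain ⟨n₀, -, h₀, -⟩ := hj 0
        exact fun h => by
          obtain ⟨n, hn, hm⟩ := h n₀
          exact h₀ n hn hm
      · obtain ⟨n₀, -, -, X, Y, hX, hY, hk, hXY, -, heq⟩ := hj k
        exact ⟨n₀, X, Y, hX, hY, hk, hXY, heq⟩
      · obtain ⟨n₀, hpos, h₀, X, Y, hX, hY, hk, hXY, hXL, heq⟩ := hj 0
        rw [hmem hX, heq] at hXL
        exact (BoundCond.holds_congr (fun q => not_congr (unbReach_slotEdge_iff hpos h₀ q)) _).2 hXL
    · rintro ⟨j, hfin, hguess, hα⟩ k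
      push Not at hfin
      obtain ⟨N, hN⟩ := hfin
      -- As `Y` lies below `n`, asking for `k + N + 1` elements forces `n > N`: the run is found in
      -- slot `j` after its last merge, and `n` is positive.
      obtain ⟨n, X, Y, hX, hY, hk, hXY, heq⟩ := hguess (k + N + 1)
      have hcard := Finset.card_le_card hY
      rw [Finset.card_range] at hcard
      refine ⟨X, Y, by omega, hXY, ?_⟩
      rw [hmem hX, heq]
      exact (BoundCond.holds_congr (fun q => not_congr (unbReach_slotEdge_iff (by omega)
        (fun m hm => hN m (by omega)) q)) _).1 hα
  rw [hset]
  exact iUnion fun j => (unbReach _ _ _).compl.inter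
    ((unbReach _ _ _).inter (holds (fun q => (unbReach _ _ _).compl) α))

theorem IsReachDefinable.unboundedly {A : Type u} {L : Set (ℕ → A × Bool)}
    (hL : IsReachDefinable L) : IsReachDefinable (unboundedly L) := by
  convert hL.quantify (· = ·) rfl using 1
  ext w
  refine forall_congr' fun k => ?_
  constructor
  · rintro ⟨X, hX, hk⟩
    exact ⟨X, X, hk, fun _ => rfl, hX⟩
  · rintro ⟨X, Y, hk, hXY, hX⟩
    obtain rfl : X = Y := Finset.ext fun i => by simpa using hXY i
    exact ⟨X, hX, hk⟩

/-- With the trivial relation `Y` is independent of `X`, so the demand on its size is void. -/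
theorem IsReachDefinable.weakExists {A : Type u} {L : Set (ℕ → A × Bool)}
    (hL : IsReachDefinable L) : IsReachDefinable (weakExists L) := by
  convert hL.quantify (fun _ _ => True) trivial using 1
  ext w
  constructor
  · rintro ⟨X, hX⟩ k
    exact ⟨X, Finset.range k, by simp, by simp, hX⟩
  · intro h
    obtain ⟨X, -, -, -, hX⟩ := h 0
    exact ⟨X, hX⟩

/-! ## From logic to weighted reachability -/

/-- Every edge may carry weight 1 and `F` is never left, so one visit to `F` extends to paths of
arbitrary weight. -/
theorem IsReachDefinable.detRun_mem {A : Type u} {Q : Type} [Finite Q] (f : Q → A → Q) (q : Q)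
    {F : Set Q} (hF : ∀ s ∈ F, ∀ a, f s a ∈ F) :
    IsReachDefinable {w : ℕ → A | ∃ n, detRun f q w n ∈ F} := by
  convert IsReachDefinable.unbReach (fun s a (_ : Bool) s' => s' = f s a) {q} F using 1
  ext w
  constructor
  · rintro ⟨n, hn⟩ k
    have hmem : ∀ d, detRun f q w (n + d) ∈ F := by
      intro d
      induction d with
      | zero => exact hn
      | succ d ih => exact hF _ ih _
    have hreach : ∀ n, WReach (fun s a (_ : Bool) s' => s' = f s a) {q} w n n
        (detRun f q w n) := by
      intro n
      induction n with
      | zero => exact .init rfl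
      | succ n ih => exact .snoc true ih rfl
    exact ⟨n + k, n + k, _, by omega, hmem k, hreach _⟩
  · intro h
    obtain ⟨n, k, s, -, hs, hr⟩ := h 0
    have : s = detRun f q w n := by
      clear hs
      induction hr with
      | init h => exact h
      | snoc b _ hE ih => rw [hE, ih, detRun]
    exact ⟨n, this ▸ hs⟩

open Classical in
theorem IsReachDefinable.exists_letter {A : Type u} (C : A → Prop) :
    IsReachDefinable {w : ℕ → A | ∃ i, C (w i)} := by
  convert IsReachDefinable.detRun_mem (fun (s : Bool) a => s || decide (C a)) false
    (F := {true}) (by simp) using 1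
  ext w
  have key : ∀ n, detRun (fun (s : Bool) a => s || decide (C a)) false w n = true ↔
      ∃ i < n, C (w i) := by
    intro n
    induction n with
    | zero => simp [detRun]
    | succ n ih => simp [detRun, ih, ← Nat.exists_lt_succ_right]
  simp only [Set.mem_ofPred_eq, Set.mem_singleton_iff, key]
  exact ⟨fun ⟨i, hi⟩ => ⟨i + 1, i, by omega, hi⟩, fun ⟨_, i, _, hi⟩ => ⟨i, hi⟩⟩

open Classical in
theorem IsReachDefinable.exists_letter_lt_letter {A : Type u} (C D : A → Prop) :
    IsReachDefinable {w : ℕ → A | ∃ i j, i < j ∧ C (w i) ∧ D (w j)} := by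
  let f : Bool × Bool → A → Bool × Bool := fun s a =>
    (s.1 || decide (C a), s.2 || (s.1 && decide (D a)))
  convert IsReachDefinable.detRun_mem f (false, false)
    (F := {s | s.2 = true}) (by simp +contextual [f]) using 1
  ext w
  have key₁ : ∀ n, (detRun f (false, false) w n).1 = true ↔ ∃ i < n, C (w i) := by
    intro n
    induction n with
    | zero => simp [detRun]
    | succ n ih =>
      have : (detRun f (false, false) w (n + 1)).1 =
        ((detRun f (false, false) w n).1 || decide (C (w n))) := rfl
      simp [this, ih, ← Nat.exists_lt_succ_right]
  have key₂ : ∀ n, (detRun f (false, false) w n).2 = true ↔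
      ∃ j < n, ∃ i < j, C (w i) ∧ D (w j) := by
    intro n
    induction n with
    | zero => simp [detRun]
    | succ n ih =>
      have : (detRun f (false, false) w (n + 1)).2 = ((detRun f (false, false) w n).2 ||
        ((detRun f (false, false) w n).1 && decide (D (w n)))) := rfl
      simp only [this, Bool.or_eq_true, ih, Bool.and_eq_true, key₁, decide_eq_true_eq,
        Nat.exists_lt_succ_right]
      refine or_congr_right ?_
      exact ⟨fun ⟨⟨i, hi, hC⟩, hD⟩ => ⟨i, hi, hC, hD⟩, fun ⟨i, hi, hC, hD⟩ => ⟨⟨i, hi, hC⟩, hD⟩⟩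
  simp only [Set.mem_ofPred_eq, key₂]
  exact ⟨fun ⟨i, j, h, hC, hD⟩ => ⟨j + 1, j, by omega, i, h, hC, hD⟩,
    fun ⟨_, j, _, i, h, hC, hD⟩ => ⟨i, j, h, hC, hD⟩⟩

/-! ### Translation of formulas by induction -/

namespace WUFormula

variable {A : Type u} {m n : ℕ}

open Classical in
/-- The word that carries a valuation of the variables in additional tracks. -/
noncomputable def encode (w : ℕ → A) (s : Fin m → ℕ) (S : Fin n → Set ℕ) :
    ℕ → A × (Fin m → Bool) × (Fin n → Bool) :=
  fun i => (w i, fun x => decide (s x = i), fun X => decide (i ∈ S X))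

def consPos (c : (A × (Fin m → Bool) × (Fin n → Bool)) × Bool) :
    A × (Fin (m + 1) → Bool) × (Fin n → Bool) :=
  (c.1.1, Fin.cons c.2 c.1.2.1, c.1.2.2)

def consSet (c : (A × (Fin m → Bool) × (Fin n → Bool)) × Bool) :
    A × (Fin m → Bool) × (Fin (n + 1) → Bool) :=
  (c.1.1, c.1.2.1, Fin.cons c.2 c.1.2.2)

theorem consPos_annotate_encode (w : ℕ → A) (s : Fin m → ℕ) (S : Fin n → Set ℕ) (x : ℕ) :
    (fun i => consPos (annotate (encode w s S) {x} i)) =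
      encode w (Fin.cons x s : Fin (m + 1) → ℕ) S := by
  funext i
  simp only [consPos, annotate, encode, Prod.mk.injEq, true_and, and_true]
  funext y
  refine Fin.cases ?_ (fun y => ?_) y
  · simp [eq_comm]
  · simp

theorem consSet_annotate_encode (w : ℕ → A) (s : Fin m → ℕ) (S : Fin n → Set ℕ)
    (X : Finset ℕ) : (fun i => consSet (annotate (encode w s S) X i)) =
      encode w s (Fin.cons (X : Set ℕ) S : Fin (n + 1) → Set ℕ) := by
  funext i
  simp only [consSet, annotate, encode, Prod.mk.injEq, true_and]
  funext Y
  refine Fin.cases ?_ (fun Y => ?_) Y <;> simp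

/-- Some mark exists and no two marks occur in order. This reduces quantification over positions to
quantification over finite sets. -/
theorem isReachDefinable_single (B : Type u) :
    IsReachDefinable {u : ℕ → B × Bool | ∃ x, ∀ i, (u i).2 = true ↔ i = x} := by
  convert (IsReachDefinable.exists_letter fun c : B × Bool => c.2 = true).inter
    (IsReachDefinable.exists_letter_lt_letter (fun c : B × Bool => c.2 = true)
      fun c => c.2 = true).compl using 1
  ext u
  simp only [Set.mem_ofPred_eq, Set.mem_inter_iff, Set.mem_compl_iff]
  constructor
  · rintro ⟨x, hx⟩
    refine ⟨⟨x, (hx x).2 rfl⟩, ?_⟩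
    rintro ⟨i, j, hij, hi, hj⟩
    rw [hx] at hi hj
    omega
  · rintro ⟨⟨x, hx⟩, h⟩
    push Not at h
    refine ⟨x, fun i => ⟨fun hi => ?_, fun hi => hi ▸ hx⟩⟩
    rcases lt_trichotomy i x with hlt | heq | hlt
    · exact (h i x hlt hi hx).elim
    · exact heq
    · exact (h x i hlt hx hi).elim

/-- Only words that encode valuations matter; on all others `L` is arbitrary. -/
theorem exists_isReachDefinable (φ : WUFormula A m n) :
    ∃ L : Set (ℕ → A × (Fin m → Bool) × (Fin n → Bool)), IsReachDefinable L ∧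
      ∀ w s S, encode w s S ∈ L ↔ φ.Sat w s S := by
  induction φ with
  | letter a x =>
    exact ⟨_, .exists_letter fun c => c.1 = a ∧ c.2.1 x = true, fun w s S => by
      simp [encode, Sat]⟩
  | eq x y =>
    exact ⟨_, .exists_letter fun c => c.2.1 x = true ∧ c.2.1 y = true, fun w s S => by
      simp only [encode, Sat, Set.mem_ofPred_eq, decide_eq_true_eq, exists_eq_left']
      exact eq_comm⟩
  | le x y =>
    refine ⟨_, (IsReachDefinable.exists_letter fun c => c.2.1 x = true ∧ c.2.1 y = true).union
      (.exists_letter_lt_letter (fun c => c.2.1 x = true) fun c => c.2.1 y = true),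
      fun w s S => ?_⟩
    simp only [encode, Sat, Set.mem_union, Set.mem_ofPred_eq, decide_eq_true_eq,
      exists_eq_left', le_iff_eq_or_lt]
    refine or_congr eq_comm ?_
    simp
  | mem x X =>
    exact ⟨_, .exists_letter fun c => c.2.1 x = true ∧ c.2.2 X = true, fun w s S => by
      simp [encode, Sat]⟩
  | not φ ih =>
    obtain ⟨L, hL, h⟩ := ih
    exact ⟨_, hL.compl, fun w s S => not_congr (h w s S)⟩
  | and φ ψ ih₁ ih₂ =>
    obtain ⟨L₁, hL₁, h₁⟩ := ih₁
    obtain ⟨L₂, hL₂, h₂⟩ := ih₂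
    exact ⟨_, hL₁.inter hL₂, fun w s S => and_congr (h₁ w s S) (h₂ w s S)⟩
  | or φ ψ ih₁ ih₂ =>
    obtain ⟨L₁, hL₁, h₁⟩ := ih₁
    obtain ⟨L₂, hL₂, h₂⟩ := ih₂
    exact ⟨_, hL₁.union hL₂, fun w s S => or_congr (h₁ w s S) (h₂ w s S)⟩
  | exPos φ ih =>
    obtain ⟨L, hL, h⟩ := ih
    refine ⟨_, ((hL.comap consPos).inter (isReachDefinable_single _)).weakExists,
      fun w s S => ?_⟩
    constructor
    · rintro ⟨X, hX, x, hx⟩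
      obtain rfl : X = {x} := Finset.ext fun i => by simpa [annotate] using hx i
      rw [Set.mem_ofPred_eq, consPos_annotate_encode, h] at hX
      exact ⟨x, hX⟩
    · rintro ⟨x, hx⟩
      refine ⟨{x}, ?_, x, by simp [annotate]⟩
      rw [Set.mem_ofPred_eq, consPos_annotate_encode, h]
      exact hx
  | exSet φ ih =>
    obtain ⟨L, hL, h⟩ := ih
    refine ⟨_, (hL.comap consSet).weakExists, fun w s S => exists_congr fun X => ?_⟩
    rw [Set.mem_ofPred_eq, consSet_annotate_encode, h]
  | unb φ ih =>
    obtain ⟨L, hL, h⟩ := ih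
    refine ⟨_, (hL.comap consSet).unboundedly, fun w s S => forall_congr' fun k =>
      exists_congr fun X => and_congr_left fun _ => ?_⟩
    rw [Set.mem_ofPred_eq, consSet_annotate_encode, h]

end WUFormula

theorem IsWeakUnboundingDefinable.isReachDefinable {A : Type u} {L : Set (ℕ → A)}
    (h : IsWeakUnboundingDefinable L) : IsReachDefinable L := by
  obtain ⟨φ, rfl⟩ := h
  obtain ⟨L, hL, h⟩ := φ.exists_isReachDefinable
  convert hL.comap fun a : A => (a, Fin.elim0, Fin.elim0) using 1
  ext w
  have : (fun i => (w i, Fin.elim0, Fin.elim0)) =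
      WUFormula.encode w (Fin.elim0 : Fin 0 → ℕ) (Fin.elim0 : Fin 0 → Set ℕ) := by
    funext i
    simp only [WUFormula.encode, Prod.mk.injEq, true_and]
    exact ⟨Subsingleton.elim _ _, Subsingleton.elim _ _⟩
  rw [Set.mem_ofPred_eq, this, h]
  rfl

/-! ## From weighted reachability to logic -/

section MarkedReach

variable {A : Type u} {σ : Type} {E : σ → A → Bool → σ → Prop} {T : Set σ} {w : ℕ → A}

/-- The states reached from `R` along an edge whose letter and weight are given. -/
def markedSucc (E : σ → A → Bool → σ → Prop) (R : Set σ) (c : A × Bool) : Set σ :=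
  {s' | ∃ s ∈ R, E s c.1 c.2 s'}

/-- Marking the edges of weight 1 turns weight into cardinality, which is what the unbounding
quantifier measures. -/
theorem WReach.exists_finset {n k : ℕ} {s : σ} (h : WReach E T w n k s) :
    ∃ X ⊆ Finset.range n, X.card = k ∧ s ∈ detRun (markedSucc E) T (annotate w X) n := by
  induction h with
  | init h => exact ⟨∅, by simp, rfl, h⟩
  | @snoc n k s s' b h hE ih =>
    obtain ⟨X, hX, rfl, hs⟩ := ih
    obtain ⟨X', hX', hcard, hn, hi⟩ := exists_finset_extend hX b
    refine ⟨X', hX', hcard, s, ?_, ?_⟩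
    · rwa [detRun_congr _ _ fun i hin => ?_]
      simp only [annotate, hi i hin.ne]
    · rwa [annotate, hn]

theorem wReach_of_mem_detRun_markedSucc {n : ℕ} {X : Finset ℕ} {s : σ}
    (h : s ∈ detRun (markedSucc E) T (annotate w X) n) :
    WReach E T w n ((Finset.range n).filter (· ∈ X)).card s := by
  induction n generalizing s with
  | zero => exact .init h
  | succ n ih =>
    obtain ⟨s₀, hs₀, hE⟩ := h
    rw [card_filter_range_succ]
    exact .snoc _ (ih hs₀) hE

/-- `Y s` is, up to position `x`, the set of positions after which `s` can be reached along edges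
whose weights are given by `X`. -/
def IsReachTable (E : σ → A → Bool → σ → Prop) (T : Set σ) (w : ℕ → A) (X : Set ℕ)
    (Y : σ → Set ℕ) (x : ℕ) : Prop :=
  (∀ i, i ∈ X → i ≤ x) ∧ ∀ i, i ≤ x → ∀ s', i ∈ Y s' ↔ ∃ s, ∃ b : Bool,
    (E s (w i) b s' ∧ (i ∈ X ↔ b = true)) ∧
      ((i = 0 ∧ s ∈ T) ∨ ∃ i', i = i' + 1 ∧ i' ∈ Y s)

/-- Position `i` stands for time `i + 1`, since no position precedes the first letter; time 0 enters
through `T`. -/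
theorem IsReachTable.mem_iff {X : Finset ℕ} {Y : σ → Set ℕ} {x : ℕ}
    (h : IsReachTable E T w X Y x) {i : ℕ} (hi : i ≤ x) (s : σ) :
    i ∈ Y s ↔ s ∈ detRun (markedSucc E) T (annotate w X) (i + 1) := by
  induction i generalizing s with
  | zero =>
    rw [h.2 0 hi]
    constructor
    · rintro ⟨s₀, b, ⟨hE, hb⟩, ⟨-, hT⟩ | ⟨i', h', -⟩⟩
      · refine ⟨s₀, hT, ?_⟩
        rwa [annotate, show decide (0 ∈ X) = b by rw [Bool.eq_iff_iff]; simpa using hb]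
      · omega
    · rintro ⟨s₀, hT, hE⟩
      exact ⟨s₀, _, ⟨hE, by simp [annotate]⟩, .inl ⟨rfl, hT⟩⟩
  | succ i ih =>
    rw [h.2 _ hi]
    constructor
    · rintro ⟨s₀, b, ⟨hE, hb⟩, ⟨h', -⟩ | ⟨i', h', hY⟩⟩
      · omega
      · obtain rfl : i = i' := by omega
        refine ⟨s₀, (ih (by omega) s₀).1 hY, ?_⟩
        rwa [annotate, show decide (i + 1 ∈ X) = b by rw [Bool.eq_iff_iff]; simpa using hb]
    · rintro ⟨s₀, hT, hE⟩
      exact ⟨s₀, _, ⟨hE, by simp [annotate]⟩, .inr ⟨i, rfl, (ih (by omega) s₀).2 hT⟩⟩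

theorem unbReach_iff_isReachTable (q : σ) : UnbReach E T w {q} ↔
    ∀ k, ∃ X : Finset ℕ, (∃ Y : σ → Finset ℕ, ∃ x,
      IsReachTable E T w X (fun s => Y s) x ∧ x ∈ Y q) ∧ k ≤ X.card := by
  classical
  constructor
  · intro h k
    -- Weight at least `k + 1` makes the path nonempty, so a last position `x` exists.
    obtain ⟨n, k', s, hk, rfl, hr⟩ := h (k + 1)
    have := hr.le
    obtain ⟨x, rfl⟩ : ∃ x, n = x + 1 := ⟨n - 1, by omega⟩
    obtain ⟨X, hX, rfl, hs⟩ := hr.exists_finset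
    set R := detRun (markedSucc E) T (annotate w X) with hR
    have hY : ∀ i ≤ x, ∀ s, i ∈ ((Finset.range (x + 1)).filter fun i => s ∈ R (i + 1)) ↔
        s ∈ R (i + 1) := fun i hi s => by
      simp only [Finset.mem_filter, Finset.mem_range, and_iff_right_iff_imp]
      omega
    refine ⟨X, ⟨fun s => (Finset.range (x + 1)).filter fun i => s ∈ R (i + 1), x, ⟨?_, ?_⟩, ?_⟩,
      by omega⟩
    · intro i hi
      have := hX hi
      simp at this
      omega
    · intro i hi s'
      simp only [Finset.mem_coe]
      rw [hY i hi]
      constructor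
      · rintro ⟨s₀, hs₀, hE⟩
        refine ⟨s₀, _, ⟨hE, by simp [annotate]⟩, ?_⟩
        obtain _ | i := i
        · exact .inl ⟨rfl, hs₀⟩
        · exact .inr ⟨i, rfl, (hY i (by omega) s₀).2 hs₀⟩
      · rintro ⟨s₀, b, ⟨hE, hb⟩, hprev⟩
        refine ⟨s₀, ?_, ?_⟩
        · rcases hprev with ⟨rfl, hT⟩ | ⟨i', rfl, hi'⟩
          · exact hT
          · exact (hY i' (by omega) s₀).1 hi'
        · rwa [annotate, show decide (i ∈ X) = b by rw [Bool.eq_iff_iff]; simpa using hb]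
    · exact (hY x le_rfl s).2 hs
  · intro h k
    obtain ⟨X, ⟨Y, x, hT, hx⟩, hk⟩ := h k
    refine ⟨x + 1, _, q, ?_, rfl,
      wReach_of_mem_detRun_markedSucc ((hT.mem_iff le_rfl q).1 (by simpa using hx))⟩
    rwa [Finset.filter_mem_eq_inter, Finset.inter_eq_right.2]
    intro i hi
    have := hT.1 i hi
    simp
    omega

end MarkedReach

/-- The relation `P` between words and valuations is expressed by a formula. -/
def WUDefinable {A : Type u} (m n : ℕ)
    (P : (ℕ → A) → (Fin m → ℕ) → (Fin n → Set ℕ) → Prop) : Prop :=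
  ∃ φ : WUFormula A m n, ∀ w s S, φ.Sat w s S ↔ P w s S

/-! ### Relations expressible by formulas -/

namespace WUDefinable

variable {A : Type u} {m n : ℕ} {P P' : (ℕ → A) → (Fin m → ℕ) → (Fin n → Set ℕ) → Prop}

theorem not (h : WUDefinable m n P) : WUDefinable m n fun w s S => ¬ P w s S := by
  obtain ⟨φ, h⟩ := h
  exact ⟨.not φ, fun w s S => not_congr (h w s S)⟩

theorem and (h : WUDefinable m n P) (h' : WUDefinable m n P') :
    WUDefinable m n fun w s S => P w s S ∧ P' w s S := by
  obtain ⟨φ, h⟩ := h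
  obtain ⟨φ', h'⟩ := h'
  exact ⟨.and φ φ', fun w s S => and_congr (h w s S) (h' w s S)⟩

theorem or (h : WUDefinable m n P) (h' : WUDefinable m n P') :
    WUDefinable m n fun w s S => P w s S ∨ P' w s S := by
  obtain ⟨φ, h⟩ := h
  obtain ⟨φ', h'⟩ := h'
  exact ⟨.or φ φ', fun w s S => or_congr (h w s S) (h' w s S)⟩

theorem imp (h : WUDefinable m n P) (h' : WUDefinable m n P') :
    WUDefinable m n fun w s S => P w s S → P' w s S := by
  simpa only [imp_iff_not_or] using h.not.or h'

theorem iff (h : WUDefinable m n P) (h' : WUDefinable m n P') :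
    WUDefinable m n fun w s S => P w s S ↔ P' w s S := by
  simpa only [iff_def] using (h.imp h').and (h'.imp h)

theorem le (x y : Fin m) : WUDefinable (A := A) m n fun _ s _ => s x ≤ s y :=
  ⟨.le x y, fun _ _ _ => Iff.rfl⟩

theorem mem (x : Fin m) (X : Fin n) : WUDefinable (A := A) m n fun _ s S => s x ∈ S X :=
  ⟨.mem x X, fun _ _ _ => Iff.rfl⟩

theorem exPos {P : (ℕ → A) → (Fin m → ℕ) → (Fin n → Set ℕ) → ℕ → Prop}
    (h : WUDefinable (m + 1) n fun w s S => P w (fun i => s i.succ) S (s 0)) :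
    WUDefinable m n fun w s S => ∃ x, P w s S x := by
  obtain ⟨φ, h⟩ := h
  exact ⟨.exPos φ, fun w s S => exists_congr fun x => h w _ S⟩

theorem allPos {P : (ℕ → A) → (Fin m → ℕ) → (Fin n → Set ℕ) → ℕ → Prop}
    (h : WUDefinable (m + 1) n fun w s S => P w (fun i => s i.succ) S (s 0)) :
    WUDefinable m n fun w s S => ∀ x, P w s S x := by
  have := (exPos (P := fun w s S x => ¬ P w s S x) h.not).not
  simpa only [not_exists, not_not] using this

theorem const (p : Prop) : WUDefinable (A := A) m n fun _ _ _ => p := by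
  have hfalse : WUDefinable (A := A) m n fun _ _ _ => ∃ x : ℕ, ¬ x ≤ x :=
    exPos (P := fun _ _ _ x => ¬ x ≤ x) (le 0 0).not
  by_cases hp : p
  · simpa [hp] using hfalse.not
  · simpa [hp] using hfalse

theorem exists_finite {ι : Type*} [Finite ι]
    {P : ι → (ℕ → A) → (Fin m → ℕ) → (Fin n → Set ℕ) → Prop}
    (h : ∀ i, WUDefinable m n (P i)) : WUDefinable m n fun w s S => ∃ i, P i w s S := by
  classical
  have key : ∀ t : Finset ι, WUDefinable m n fun w s S => ∃ i ∈ t, P i w s S := by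
    intro t
    induction t using Finset.induction_on with
    | empty => simpa using const False
    | insert i t _ ih => simpa only [Finset.exists_mem_insert] using (h i).or ih
  have := Fintype.ofFinite ι
  simpa using key Finset.univ

theorem forall_finite {ι : Type*} [Finite ι]
    {P : ι → (ℕ → A) → (Fin m → ℕ) → (Fin n → Set ℕ) → Prop}
    (h : ∀ i, WUDefinable m n (P i)) : WUDefinable m n fun w s S => ∀ i, P i w s S := by
  simpa only [not_exists, not_not] using (exists_finite fun i => (h i).not).not

theorem letter [Finite A] (C : A → Prop) (x : Fin m) :
    WUDefinable m n fun w s _ => C (w (s x)) := by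
  have := exists_finite fun a : A => and (m := m) (n := n) (P' := fun _ _ _ => C a)
    ⟨.letter a x, fun w s S => Iff.rfl⟩ (const (C a))
  simpa only [WUFormula.Sat, exists_eq_left'] using this

theorem eq_zero (x : Fin m) : WUDefinable (A := A) m n fun _ s _ => s x = 0 := by
  convert allPos (A := A) (n := n) (P := fun _ s _ z => s x ≤ z) (le x.succ 0) using 4 with w s S
  exact ⟨fun h z => h ▸ z.zero_le, fun h => Nat.le_zero.1 (h 0)⟩

theorem eq_succ (x y : Fin m) : WUDefinable (A := A) m n fun _ s _ => s x = s y + 1 := by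
  convert (le (A := A) (n := n) x y).not.and (allPos (P := fun _ s _ z => s x ≤ z ∨ z ≤ s y)
    ((le x.succ 0).or (le 0 y.succ))) using 4 with w s S
  constructor
  · intro h
    exact ⟨by omega, fun z => by omega⟩
  · rintro ⟨h, hz⟩
    have := hz (s y + 1)
    omega

/-- Each `exSet` binds variable `0` and shifts the rest, so the single free set variable ends up
last. -/
theorem exFinsets (r : ℕ) {P : (ℕ → A) → (Fin m → ℕ) → (Fin (r + 1) → Set ℕ) → Prop}
    (h : WUDefinable m (r + 1) P) : WUDefinable m 1 fun w s S => ∃ Y : Fin r → Finset ℕ,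
      P w s (Fin.snoc (α := fun _ => Set ℕ) (fun i => (Y i : Set ℕ)) (S 0)) := by
  induction r with
  | zero =>
    convert h using 4 with w s S
    have : ∀ Y : Fin 0 → Finset ℕ,
        (Fin.snoc (α := fun _ => Set ℕ) (fun i => (Y i : Set ℕ)) (S 0)) = S := by
      intro Y
      funext i
      obtain rfl : i = Fin.last 0 := Subsingleton.elim (α := Fin 1) _ _
      rw [Fin.snoc_last]
      rfl
    simp [this]
  | succ r ih =>
    obtain ⟨φ, h⟩ := h
    obtain ⟨ψ, hψ⟩ := ih ⟨.exSet φ, fun w s S => exists_congr fun Z => h w s _⟩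
    refine ⟨ψ, fun w s S => (hψ w s S).trans ?_⟩
    have key : ∀ (Z : Finset ℕ) (Y : Fin r → Finset ℕ),
        (Fin.cons (Z : Set ℕ) (Fin.snoc (α := fun _ => Set ℕ) (fun i => (Y i : Set ℕ)) (S 0)) :
          Fin (r + 1 + 1) → Set ℕ) = Fin.snoc (α := fun _ => Set ℕ)
            (fun i => ((Fin.cons Z Y : Fin (r + 1) → Finset ℕ) i : Set ℕ)) (S 0) := by
      intro Z Y
      rw [Fin.cons_snoc_eq_snoc_cons]
      congr 1
      funext i
      refine Fin.cases ?_ (fun i => ?_) i <;> simp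
    simp only [key]
    constructor
    · rintro ⟨Y, Z, hP⟩
      exact ⟨_, hP⟩
    · rintro ⟨Y, hP⟩
      exact ⟨Fin.tail Y, Y 0, by rwa [Fin.cons_self_tail]⟩

theorem isReachTable [Finite A] {σ : Type} [Finite σ] (E : σ → A → Bool → σ → Prop) (T : Set σ)
    (x : Fin m) (X : Fin n) (Y : σ → Fin n) :
    WUDefinable m n fun w s S => IsReachTable E T w (S X) (fun q => S (Y q)) (s x) := by
  refine and (allPos (P := fun w s S i => i ∈ S X → i ≤ s x) ((mem 0 X).imp (le 0 x.succ)))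
    (allPos (P := fun w s S i => i ≤ s x → ∀ s', i ∈ S (Y s') ↔ ∃ q, ∃ b : Bool,
      (E q (w i) b s' ∧ (i ∈ S X ↔ b = true)) ∧
        ((i = 0 ∧ q ∈ T) ∨ ∃ i', i = i' + 1 ∧ i' ∈ S (Y q))) ?_)
  refine (le 0 x.succ).imp (forall_finite fun s' => (mem 0 (Y s')).iff (exists_finite fun q =>
    exists_finite fun b => ((letter (fun a => E q a b s') 0).and ((mem 0 X).iff (const _))).and
      (((eq_zero 0).and (const _)).or ?_)))
  exact exPos (P := fun w s S i' => s 0 = i' + 1 ∧ i' ∈ S (Y q))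
    ((eq_succ (Fin.succ 0) 0).and (mem 0 (Y q)))

/-- The unbounding quantifier binds the weight set, and `r` existential set quantifiers bind the
reachability table, one set per state. -/
theorem unbReach [Finite A] {σ : Type} [Finite σ] (E : σ → A → Bool → σ → Prop) (T : Set σ)
    (q : σ) : WUDefinable 0 0 fun w _ _ => UnbReach E T w {q} := by
  obtain ⟨r, ⟨e⟩⟩ := Finite.exists_equiv_fin σ
  obtain ⟨φ, hφ⟩ := exFinsets (m := 0) r (exPos (P := fun w s S x =>
    IsReachTable E T w (S (Fin.last r)) (fun s => S (e s).castSucc) x ∧ x ∈ S (e q).castSucc)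
    ((isReachTable E T 0 (Fin.last r) fun s => (e s).castSucc).and (mem 0 (e q).castSucc)))
  refine ⟨.unb φ, fun w s S => ?_⟩
  refine Iff.trans ?_ (unbReach_iff_isReachTable q).symm
  refine forall_congr' fun k => exists_congr fun X => and_congr_left fun _ => ?_
  rw [hφ]
  simp only [Fin.snoc_last, Fin.snoc_castSucc, Fin.cons_zero, Finset.mem_coe]
  exact (e.symm.arrowCongr (Equiv.refl _)).exists_congr fun Y => by
    simp [Equiv.arrowCongr]

theorem holds {Γ : Type} {P : (ℕ → A) → Γ → Prop}
    (h : ∀ c, WUDefinable m n fun w _ _ => P w c) (α : BoundCond Γ) :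
    WUDefinable m n fun w _ _ => α.Holds (P w) := by
  induction α with
  | tru => exact const True
  | bounded c => exact h c
  | not α ih => exact ih.not
  | and α β ih₁ ih₂ => exact ih₁.and ih₂
  | or α β ih₁ ih₂ => exact ih₁.or ih₂

end WUDefinable

theorem IsReachDefinable.isWeakUnboundingDefinable {A : Type u} [Finite A] {L : Set (ℕ → A)}
    (h : IsReachDefinable L) : IsWeakUnboundingDefinable L := by
  obtain ⟨σ, _, E, T, α, h⟩ := h
  obtain ⟨φ, hφ⟩ := WUDefinable.holds (fun q => (WUDefinable.unbReach E T q).not) α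
  exact ⟨φ, Set.ext fun w => (hφ w _ _).trans (h w).symm⟩

theorem mainTheorem1 {A : Type u} [Finite A] :
    (∀ L : Set (ℕ → A), IsWeakUnboundingDefinable L ↔ IsDetMaxRecognizable L) ∧
    (∀ L : Set (ℕ → A), IsDetMaxRecognizable L → IsDetMaxRecognizable Lᶜ) ∧
    (∀ L K : Set (ℕ → A), IsDetMaxRecognizable L → IsDetMaxRecognizable K →
      IsDetMaxRecognizable (L ∪ K) ∧ IsDetMaxRecognizable (L ∩ K)) ∧
    (∀ L : Set (ℕ → A × Bool), IsDetMaxRecognizable L →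
      IsDetMaxRecognizable (weakExists L)) ∧
    (∀ L : Set (ℕ → A × Bool), IsDetMaxRecognizable L →
      IsDetMaxRecognizable (unboundedly L)) := by
  simp only [← isReachDefinable_iff]
  exact ⟨fun L => ⟨fun h => h.isReachDefinable, fun h => h.isWeakUnboundingDefinable⟩,
    fun L h => h.compl, fun L K hL hK => ⟨hL.union hK, hL.inter hK⟩,
    fun L h => h.weakExists, fun L h => h.unboundedly⟩
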